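/- **Asymptotic information rate with $L$ homogeneous sensors.** Slots are numbered by integers and monitoring starts in slot $1$. In every slot each of $L$ sensors independently takes a sample with probability $r\in(0,1)$ and puts it in its own queue, where it is available from the next slot on. Let $\boldsymbol Q_k\in\mathbb N^L$ be the vector of queue lengths at the beginning of slot $k$, and let $\|\boldsymbol Q_k\|_0$ be the number of its nonzero entries. If $\|\boldsymbol Q_k\|_0>0$, one nonempty queue is selected uniformly at random and one of its packets is transmitted; the packet is chosen by a fixed rule that depends on the ages of the packets in that queue (for example the oldest). The transmission succeeds ($Y_k=1$) or fails ($Y_k=0$), independently of everything else; a packet stays in its queue until it is delivered. If $\|\boldsymbol Q_k\|_0=0$, then $Y_k=\emptyset$. The decision maker observes $(U_k,Y_k,J_k,Z_k)$, which on success are the selected sensor, $1$, the sampling slot of the packet and its measurement $X_{J_k,U_k}$; otherwise $U_k,J_k,Z_k$ are unobserved. For $\nu\in\{0,1,\dots,\infty\}$, let $\mathbb P_\nu$ be the law under which a transmission in slot $k$ succeeds with probability $p_0$ if $k\le\nu$ and $p_1$ if $k>\nu$, the measurements $X_{k,l}$ are independent of each other and of everything else with law $f_0$ if $k\le\nu$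 and $f_1$ if $k>\nu$, and the packets that are in the queues at the beginning of slot $1$ (all sampled in slots $\le 0$, at most one per sensor and slot) have an arbitrary initial law that does not depend on $\nu$ and is independent of the measurements and of the later randomness. Let $$l_{0,n}=\log\frac{d\,\mathbb P_0\big((U_k,Y_k,J_k,Z_k)_{k=1}^n\in\cdot\mid \boldsymbol Q_1\big)}{d\,\mathbb P_\infty\big((U_k,Y_k,J_k,Z_k)_{k=1}^n\in\cdot\mid \boldsymbol Q_1\big)}$$ be the log-likelihood ratio, evaluated at the observed path. Assume $Lr<\min\{p_0,p_1\}$, that $p_1=1$ if $p_0=1$, and that $I(f_1,f_0)=\int\log\frac{df_1}{df_0}\,df_1$, the Kullback–Leibler divergence of $f_1$ from $f_0$, is finite (in particular $f_1\ll f_0$). Put $I(p_1,p_0)=p_1\log\frac{p_1}{p_0}+(1-p_1)\log\frac{1-p_1}{1-p_0}$, with $0\log 0=0\log\frac00=0$. Consider the augmented Markov chain whose state in a slot consists of the ages of the packets in the queues at the beginning of the slot (hence $\boldsymbol Q$), of $U$ and $Y$, and of the age and the measurement $Z$ of the delivered packet (if any), in the post-change regime, that is, with success probability $p_1$ and all measurements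 of law $f_1$. This chain has exactly one stationary distribution $\Pi$. The log-likelihood ratio of one slot, $$\Lambda=\mathbf 1_{\{\|\boldsymbol Q\|_0>0\}}\log\frac{\mathbb P_0(Y\mid\|\boldsymbol Q\|_0>0)}{\mathbb P_\infty(Y\mid\|\boldsymbol Q\|_0>0)}+\mathbf 1_{\{Y=1\}}\log\frac{df_1}{df_0}(Z),$$ is $\Pi$-integrable, and $\mathbb P_0$-almost surely $$\lim_{n\to\infty}\frac1n\,l_{0,n}=\mathbb E_\Pi[\Lambda]=\Pi(\|\boldsymbol Q\|_0>0)\,I(p_1,p_0)+\Pi(Y=1)\,I(f_1,f_0).$$ -/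

import Mathlib

open MeasureTheory ProbabilityTheory unitInterval Filter Topology

namespace LossyLink

noncomputable section

/-- Contents of the `L` transmit queues at the beginning of a slot: for each sensor, the set of the
ages of the waiting packets. A sensor takes at most one sample per slot, so the packets of one
queue have distinct ages. A packet sampled in slot `j` has age `k - 1 - j` at the beginning of
slot `k`, so the packet sampled in the immediately preceding slot has age `0`. -/
abbrev Contents (L : ℕ) := Fin L → Finset ℕ

/-- What happens on the channel in a slot: `Sum.inl ()` is "no transmission" (`Y = ∅`),
`Sum.inr (Sum.inl ())` is "transmission failed" (`Y = 0`), and `Sum.inr (Sum.inr a)` is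
"transmission succeeded" (`Y = 1`), carrying the data `a` of the delivered packet. -/
abbrev Outcome (α : Type*) := Unit ⊕ Unit ⊕ α

/-- Apply a function to the data of the delivered packet, if there is one. -/
def Outcome.map {α β : Type*} (g : α → β) : Outcome α → Outcome β :=
  Sum.map id (Sum.map id g)

/-- `Y = 1`. -/
def Outcome.IsSuccess {α : Type*} : Outcome α → Prop
  | Sum.inr (Sum.inr _) => True
  | _ => False

/-- The observation `(U, Y, J, Z)` of the decision maker in one slot; on success it carries the
sensor `U`, the sampling slot `J` and the measurement `Z`, otherwise these are unobserved. -/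
abbrev Obs (L : ℕ) (E : Type*) := Outcome (Fin L × ℤ × E)

/-- The randomness of one slot other than the measurements: the arrival indicators of the
sensors; for every nonempty set `s` of sensors, the sensor that is selected if `s` is the set of
sensors with a nonempty queue; and whether a transmission in this slot is successful. -/
abbrev SlotNoise (L : ℕ) := (Fin L → Bool) × ({s : Finset (Fin L) // s.Nonempty} → Fin L) × Bool

/-- Law of the randomness of a slot: arrivals are independent Bernoulli (`r`), the selection is
uniform on the set of nonempty queues, transmissions succeed with probability `p`. -/
def slotLaw (L : ℕ) (r p : I) : Measure (SlotNoise L) :=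
  (Measure.pi fun _ => bernoulliMeasure true false r).prod
    ((Measure.pi fun s : {s : Finset (Fin L) // s.Nonempty} =>
      (PMF.uniformOfFinset s.1 s.2).toMeasure).prod (bernoulliMeasure true false p))

/-- The sensors with a nonempty queue. -/
def active {L : ℕ} (w : Contents L) : Finset (Fin L) :=
  Finset.univ.filter fun l => (w l).Nonempty

/-- The vector of queue lengths. -/
def queueLength {L : ℕ} (w : Contents L) : Fin L → ℕ := fun l => (w l).card

/-- The channel use in a slot that begins with queue contents `w`. If some queue is nonempty, the
selected sensor `u` transmits its packet of age `d (w u)`, where `d` is the discipline within a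
queue; a delivered packet is recorded by its sensor and its age. -/
def attempt {L : ℕ} (d : Finset ℕ → ℕ) (w : Contents L) (ξ : SlotNoise L) :
    Outcome (Fin L × ℕ) :=
  if h : (active w).Nonempty then
    if ξ.2.2 = true then
      Sum.inr (Sum.inr (ξ.2.1 ⟨active w, h⟩, d (w (ξ.2.1 ⟨active w, h⟩))))
    else Sum.inr (Sum.inl ())
  else Sum.inl ()

/-- Remove the delivered packet, if any; other packets stay until they are delivered. -/
def depart {L : ℕ} (w : Contents L) : Outcome (Fin L × ℕ) → Contents L
  | Sum.inr (Sum.inr (u, a)) => Function.update w u ((w u).erase a)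
  | _ => w

/-- Queue contents at the beginning of the next slot: the delivered packet leaves, the remaining
packets become one slot older, and the new samples enter with age `0`. -/
def advance {L : ℕ} (w : Contents L) (o : Outcome (Fin L × ℕ)) (A : Fin L → Bool) : Contents L :=
  fun l => (depart w o l).image Nat.succ ∪ (if A l = true then {0} else ∅)

/-! ### The observed process -/

/-- A sample point: the queue contents at the beginning of slot `1`, the randomness of the slots
(the entry with index `k` belongs to slot `k + 1`), and the measurements `X (j, l)` of sensor `l`
in slot `j`. -/
abbrev SampleSpace (L : ℕ) (E : Type*) :=
  Contents L × (ℕ → SlotNoise L) × (ℤ × Fin L → E)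

/-- Queue contents at the beginning of slot `k + 1`. -/
def contents {L : ℕ} {E : Type*} (d : Finset ℕ → ℕ) (ω : SampleSpace L E) : ℕ → Contents L
  | 0 => ω.1
  | k + 1 => advance (contents d ω k) (attempt d (contents d ω k) (ω.2.1 k)) (ω.2.1 k).1

/-- The observation `(U, Y, J, Z)` in slot `k + 1`: on success, a packet of age `a` from sensor
`u` was sampled in slot `J = k - a` and contains the measurement `Z = X (J, u)`. -/
def obs {L : ℕ} {E : Type*} (d : Finset ℕ → ℕ) (ω : SampleSpace L E) (k : ℕ) : Obs L E :=
  (attempt d (contents d ω k) (ω.2.1 k)).map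
    fun x => (x.1, (k : ℤ) - x.2, ω.2.2 ((k : ℤ) - x.2, x.1))

/-- The observations in the slots `1, …, n`. -/
def obsPath {L : ℕ} {E : Type*} (d : Finset ℕ → ℕ) (n : ℕ) (ω : SampleSpace L E) :
    Fin n → Obs L E :=
  fun k => obs d ω k

/-- The queue length vector `Q₁` at the beginning of slot `1`. -/
def initialQueue {L : ℕ} {E : Type*} (ω : SampleSpace L E) : Fin L → ℕ := queueLength ω.1

variable {E : Type*} [MeasurableSpace E]

/-- The law `P_ν` when the change occurs at the end of slot `ν`, with `ν = ⊤` for no change: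
initial contents with law `init`, and, independently, slots `k ≤ ν` with success probability `p₀`
and slots `k > ν` with success probability `p₁`, and measurements that have law `f₀` if taken in a
slot `j ≤ ν` and law `f₁` if taken in a slot `j > ν`, all independent. (The change point is
nonnegative, so slots `j ≤ 0` are always before the change.) -/
def changeLaw {L : ℕ} (r p₀ p₁ : I) (f₀ f₁ : Measure E) (init : Measure (Contents L)) (ν : ℕ∞) :
    Measure (SampleSpace L E) :=
  init.prod
    ((Measure.infinitePi fun k : ℕ =>
        slotLaw L r (if ((k + 1 : ℕ) : ℕ∞) ≤ ν then p₀ else p₁)).prod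
      (Measure.infinitePi fun x : ℤ × Fin L =>
        if ((x.1.toNat : ℕ) : ℕ∞) ≤ ν then f₀ else f₁))

/-- The law under `P_ν` of the observations in slots `1, …, n`, conditionally on `Q₁ = q`. -/
def condObsLaw {L : ℕ} (d : Finset ℕ → ℕ) (r p₀ p₁ : I) (f₀ f₁ : Measure E)
    (init : Measure (Contents L)) (ν : ℕ∞) (n : ℕ) (q : Fin L → ℕ) : Measure (Fin n → Obs L E) :=
  (cond (changeLaw r p₀ p₁ f₀ f₁ init ν) (initialQueue ⁻¹' {q})).map (obsPath d n)

/-- The log-likelihood ratio `l_{ν,n}` of `P_ν` against `P_∞` of the observations in the slots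
`1, …, n` given `Q₁`, evaluated at the observed path. -/
def logLR {L : ℕ} (d : Finset ℕ → ℕ) (r p₀ p₁ : I) (f₀ f₁ : Measure E)
    (init : Measure (Contents L)) (ν : ℕ∞) (n : ℕ) (ω : SampleSpace L E) : ℝ :=
  llr (condObsLaw d r p₀ p₁ f₀ f₁ init ν n (initialQueue ω))
    (condObsLaw d r p₀ p₁ f₀ f₁ init ⊤ n (initialQueue ω)) (obsPath d n ω)

/-! ### The augmented Markov chain -/

/-- State of the augmented chain: the queue contents at the beginning of the slot (which determine
`Q`), and the outcome of the slot with `U`, `Y`, the age (instead of the sampling slot `J`) and the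
measurement `Z` of the delivered packet. -/
abbrev AugState (L : ℕ) (E : Type*) := Contents L × Outcome (Fin L × ℕ × E)

/-- One step of the augmented chain: the queues move on to the next slot, in which a delivered
packet contains the measurement `x.2`. -/
def chainStep {L : ℕ} {E : Type*} (d : Finset ℕ → ℕ) (s : AugState L E) (x : SlotNoise L × E) :
    AugState L E :=
  let w := advance s.1 (s.2.map fun y => (y.1, y.2.1)) x.1.1
  (w, (attempt d w x.1).map fun y => (y.1, y.2, x.2))

lemma measurableSingletonClass_outcome {α : Type*} [MeasurableSpace α]
    [MeasurableSingletonClass α] : MeasurableSingletonClass (Outcome α) := by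
  have hinl : ∀ {β γ : Type _} [MeasurableSpace β] [MeasurableSpace γ]
      [MeasurableSingletonClass β] [MeasurableSingletonClass γ],
      MeasurableSingletonClass (β ⊕ γ) := by
    intro β γ _ _ _ _
    refine ⟨fun x => ?_⟩
    rcases x with x | x
    · simpa using (measurableSet_singleton x).inl_image (β := γ)
    · simpa using (measurableSet_singleton x).inr_image (α := β)
  have : MeasurableSingletonClass (Unit ⊕ α) := hinl
  exact hinl

lemma measurable_outcome_map {α β : Type*} [MeasurableSpace α] [MeasurableSpace β] {g : α → β}
    (hg : Measurable g) : Measurable (Outcome.map g) :=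
  measurable_id.sumMap (measurable_id.sumMap hg)

lemma measurable_chainStep {L : ℕ} (d : Finset ℕ → ℕ) :
    Measurable fun y : AugState L E × (SlotNoise L × E) => chainStep d y.1 y.2 := by
  have hH : Measurable fun c : (Contents L × Outcome (Fin L × ℕ) × SlotNoise L) × E =>
      ((advance c.1.1 c.1.2.1 c.1.2.2.1,
        (attempt d (advance c.1.1 c.1.2.1 c.1.2.2.1) c.1.2.2).map
          fun y => (y.1, y.2, c.2)) : AugState L E) := by
    have := measurableSingletonClass_outcome (α := Fin L × ℕ)
    refine measurable_from_prod_countable_right fun c => ?_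
    dsimp only
    generalize attempt d (advance c.1 c.2.1 c.2.2.1) c.2.2 = o
    refine Measurable.prodMk (f := fun _ => advance c.1 c.2.1 c.2.2.1) measurable_const ?_
    rcases o with _ | _ | ⟨u, a⟩
    · exact measurable_const
    · exact (measurable_const :
        Measurable fun _ : E => (Sum.inr (Sum.inl ()) : Outcome (Fin L × ℕ × E)))
    · exact measurable_inr.comp (measurable_inr.comp (by fun_prop))
  have hg : Measurable fun y : AugState L E × (SlotNoise L × E) =>
      (((y.1.1, y.1.2.map (fun z => (z.1, z.2.1)), y.2.1), y.2.2) :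
        (Contents L × Outcome (Fin L × ℕ) × SlotNoise L) × E) := by
    have := (measurable_outcome_map (α := Fin L × ℕ × E) (g := fun z => (z.1, z.2.1))
      (by fun_prop)).comp (measurable_snd.comp
        (measurable_fst : Measurable (Prod.fst : AugState L E × (SlotNoise L × E) → _)))
    exact ((measurable_fst.comp measurable_fst).prodMk
      (this.prodMk (measurable_fst.comp measurable_snd))).prodMk
      (measurable_snd.comp measurable_snd)
  exact hH.comp hg

/-- Transition kernel of the augmented chain when arrivals have probability `r`, transmissions
succeed with probability `p`, and measurements have law `f`. -/
def augKernel {L : ℕ} (d : Finset ℕ → ℕ) (r p : I) (f : Measure E) :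
    Kernel (AugState L E) (AugState L E) :=
  (Kernel.id.prod (Kernel.const (AugState L E) ((slotLaw L r p).prod f))).map
    fun y => chainStep d y.1 y.2

/-- The conditional probability of the value of `Y`, given that some queue is nonempty, if
transmissions succeed with probability `p`. -/
def channelProb {α : Type*} (p : I) : Outcome α → ℝ
  | Sum.inl _ => 0
  | Sum.inr (Sum.inl _) => 1 - p
  | Sum.inr (Sum.inr _) => p

/-- `1_{Y = 1} log (f₁ (Z) / f₀ (Z))`, where `f₁ / f₀` is the Radon–Nikodym derivative. -/
def measurementLLR {L : ℕ} (f₀ f₁ : Measure E) : Outcome (Fin L × ℕ × E) → ℝ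
  | Sum.inr (Sum.inr x) => llr f₁ f₀ x.2.2
  | _ => 0

/-- The log-likelihood ratio of one slot. -/
def slotLLR {L : ℕ} (p₀ p₁ : I) (f₀ f₁ : Measure E) (s : AugState L E) : ℝ :=
  {s : AugState L E | queueLength s.1 ≠ 0}.indicator
      (fun s => Real.log (channelProb p₁ s.2 / channelProb p₀ s.2)) s
    + measurementLLR f₀ f₁ s.2

/-- The Kullback–Leibler divergence `D(p₁ ‖ p₀)` of Bernoulli distributions. -/
def klBernoulli (p₁ p₀ : I) : ℝ :=
  (p₁ : ℝ) * Real.log (p₁ / p₀) + (1 - p₁) * Real.log ((1 - p₁) / (1 - p₀))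

end

end LossyLink

/-! Both sides of the limit are computed separately and then compared; no ergodic theorem for the
augmented chain is used.

Stationary side. The next step of the chain depends on the present state only through the packets
left after the departure. If none are left, the next law is a fixed measure `κ`, so `{postLoad = 0}`
is an atom. Off the atom the mean of `postLoad` drops by `p - L * r > 0` per step. Hence excursions
from the atom have finite mean length, their occupation measure normalises to an invariant law, and
that law is the only one (`existsUnique_invariant_of_drift`). Stationarity makes the success
probability equal to the arrival rate `L * r` (`stationary_rate`). Whether a slot is busy is
independent of its success flag and of the measurement, so the busy probability is `L * r / p` and
the mean of `slotLLR` factorises (`integral_slotLLR`).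

Likelihood side. Arrivals and selections have the same law before and after the change, and a packet
is delivered at most once, so the delivered measurements sit at distinct coordinates of the
measurement field. Relative to the hidden randomness the density is therefore a product of slot
ratios. Each ratio is a function of the observation of its slot alone, so the product is also the
density of the observed path given `Q₁` (`condObsLaw_zero_eq_withDensity`).

Its logarithm is a weighted count of successes and failures plus the measurement terms of packets
sampled after the change. The backlog is sublinear, which gives successes the rate `L * r`; an
exponential bound ties failures to successes; only finitely many delivered packets predate the
change (`delivery_rates`). Given the queue noise, the other delivered measurements are i.i.d. with
law `f₁`, and the strong law applies to them (`tendsto_freshLLR`). -/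

namespace LossyLink

open scoped ENNReal

/-! ### Invariant measures of a chain with an atom and negative drift -/

section Atom

variable {X : Type*} [MeasurableSpace X] (K : Kernel X X) (Φ : X → ℕ) (κ : Measure X)

/-- The law of the chain started from `κ` after `k` steps, killed on visiting `{Φ = 0}`. -/
noncomputable def excursion : ℕ → Measure X
  | 0 => κ
  | k + 1 => ((excursion k).restrict {s | Φ s ≠ 0}).bind K

/-- The expected occupation measure of an excursion away from `{Φ = 0}`. -/
noncomputable def occupation : Measure X := Measure.sum (excursion K Φ κ)

variable {K Φ κ}

lemma measurableSet_ne_zero (hΦ : Measurable Φ) : MeasurableSet {s | Φ s ≠ 0} :=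
  hΦ (measurableSet_singleton 0).compl

/-- Regeneration: all mass on the atom restarts from `κ`, and the rest moves on as in an excursion.
-/
lemma bind_eq_atom_add [IsMarkovKernel K] (hΦ : Measurable Φ) (hatom : ∀ s, Φ s = 0 → K s = κ)
    (μ : Measure X) :
    μ.bind K = μ {s | Φ s = 0} • κ + (μ.restrict {s | Φ s ≠ 0}).bind K := by
  have hm : MeasurableSet {s | Φ s = 0} := hΦ (measurableSet_singleton 0)
  have h1 : (μ.restrict {s | Φ s = 0}).bind K = μ {s | Φ s = 0} • κ := by
    rw [Measure.bind_congr_right (g := fun _ => κ)]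
    · rw [Measure.bind_const, Measure.restrict_apply_univ]
    · exact (ae_restrict_iff' hm).2 (ae_of_all _ hatom)
  rw [← h1, ← Measure.comp_add]
  congr 1
  exact (Measure.restrict_add_restrict_compl hm).symm

lemma excursion_succ_univ [IsMarkovKernel K] (k : ℕ) :
    excursion K Φ κ (k + 1) Set.univ = excursion K Φ κ k {s | Φ s ≠ 0} := by
  rw [excursion, Measure.bind_apply MeasurableSet.univ K.measurable.aemeasurable]
  simp

/-- Foster–Lyapunov argument: every step off the atom costs at least `δ` of the mean of `Φ`, and the
costs telescope. Letting `n` grow bounds the mean excursion length. -/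
lemma sum_excursion_ne_zero_le (hΦ : Measurable Φ) {δ : ℝ≥0∞}
    (hdrift : ∀ s, Φ s ≠ 0 → ∫⁻ t, Φ t ∂(K s) + δ ≤ Φ s) (n : ℕ) :
    δ * ∑ k ∈ Finset.range n, excursion K Φ κ k {s | Φ s ≠ 0}
      + ∫⁻ s, Φ s ∂(excursion K Φ κ n) ≤ ∫⁻ s, Φ s ∂κ := by
  induction n with
  | zero => simp [excursion]
  | succ n ih =>
    refine le_trans ?_ ih
    rw [Finset.sum_range_succ, mul_add, add_assoc]
    gcongr
    rw [excursion, Measure.lintegral_bind K.measurable.aemeasurable (by fun_prop)]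
    rw [← lintegral_indicator_const (measurableSet_ne_zero hΦ),
      ← lintegral_indicator (measurableSet_ne_zero hΦ), ← lintegral_add_left]
    · refine lintegral_mono fun s => ?_
      by_cases hs : Φ s = 0
      · simp [hs]
      · simpa [hs, add_comm] using hdrift s hs
    · exact measurable_const.indicator (measurableSet_ne_zero hΦ)

lemma tsum_excursion_ne_zero_ne_top (hΦ : Measurable Φ) {δ : ℝ≥0∞} (hδ : δ ≠ 0) (hδ' : δ ≠ ∞)
    (hint : ∫⁻ s, Φ s ∂κ ≠ ∞)
    (hdrift : ∀ s, Φ s ≠ 0 → ∫⁻ t, Φ t ∂(K s) + δ ≤ Φ s) :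
    ∑' k, excursion K Φ κ k {s | Φ s ≠ 0} ≠ ∞ := by
  have : ∑' k, excursion K Φ κ k {s | Φ s ≠ 0} ≤ δ⁻¹ * ∫⁻ s, Φ s ∂κ := by
    rw [ENNReal.tsum_eq_iSup_nat]
    refine iSup_le fun n => ?_
    rw [← ENNReal.mul_le_iff_le_inv hδ hδ']
    exact le_self_add.trans (sum_excursion_ne_zero_le hΦ hdrift n)
  exact ne_top_of_le_ne_top (ENNReal.mul_ne_top (ENNReal.inv_ne_top.2 hδ) hint) this

lemma occupation_univ [IsMarkovKernel K] [IsProbabilityMeasure κ] :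
    occupation K Φ κ Set.univ = 1 + ∑' k, excursion K Φ κ k {s | Φ s ≠ 0} := by
  rw [occupation, Measure.sum_apply _ MeasurableSet.univ, tsum_eq_zero_add' ENNReal.summable]
  simp only [excursion_succ_univ]
  simp [excursion]

/-- An excursion is killed after its visit to the atom, and it ends almost surely because its mean
length is finite. In the proof, the finite mass off the atom is cancelled from the total mass. -/
lemma occupation_atom [IsMarkovKernel K] [IsProbabilityMeasure κ] (hΦ : Measurable Φ)
    (hfin : ∑' k, excursion K Φ κ k {s | Φ s ≠ 0} ≠ ∞) :
    occupation K Φ κ {s | Φ s = 0} = 1 := by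
  have hm : MeasurableSet {s | Φ s = 0} := hΦ (measurableSet_singleton 0)
  have h1 := measure_add_measure_compl (μ := occupation K Φ κ) hm
  rw [occupation_univ] at h1
  have h2 : occupation K Φ κ {s | Φ s = 0}ᶜ = ∑' k, excursion K Φ κ k {s | Φ s ≠ 0} := by
    rw [occupation, Measure.sum_apply _ hm.compl]
    rfl
  rw [h2] at h1
  exact (ENNReal.add_left_inj hfin).1 h1

lemma bind_sum (m : ℕ → Measure X) : (Measure.sum m).bind K = Measure.sum fun k => (m k).bind K := by
  ext s hs
  rw [Measure.bind_apply hs K.measurable.aemeasurable, Measure.sum_apply _ hs,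
    lintegral_sum_measure]
  simp_rw [Measure.bind_apply hs K.measurable.aemeasurable]

lemma occupation_invariant [IsMarkovKernel K] [IsProbabilityMeasure κ] (hΦ : Measurable Φ)
    (hatom : ∀ s, Φ s = 0 → K s = κ)
    (hfin : ∑' k, excursion K Φ κ k {s | Φ s ≠ 0} ≠ ∞) :
    (occupation K Φ κ).bind K = occupation K Φ κ := by
  rw [bind_eq_atom_add hΦ hatom, occupation_atom hΦ hfin, one_smul]
  conv_lhs => rw [occupation, Measure.restrict_sum _ (measurableSet_ne_zero hΦ), bind_sum]
  ext s hs
  rw [Measure.add_apply, occupation, Measure.sum_apply _ hs, Measure.sum_apply _ hs,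
    tsum_eq_zero_add' (f := fun k => excursion K Φ κ k s) ENNReal.summable]
  rfl

lemma bind_mono {μ ν : Measure X} (h : μ ≤ ν) : μ.bind K ≤ ν.bind K := by
  refine Measure.le_iff.2 fun s hs => ?_
  rw [Measure.bind_apply hs K.measurable.aemeasurable, Measure.bind_apply hs K.measurable.aemeasurable]
  exact lintegral_mono' h le_rfl

/-- Minimality of the occupation measure: iterating `ρ = ρ(atom) • κ + (ρ off the atom) K` produces
the partial sums of the excursion laws as lower bounds. -/
lemma smul_occupation_le [IsMarkovKernel K] (hΦ : Measurable Φ)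
    (hatom : ∀ s, Φ s = 0 → K s = κ) {ρ : Measure X} (hρ : ρ.bind K = ρ) :
    ρ {s | Φ s = 0} • occupation K Φ κ ≤ ρ := by
  have key : ∀ n : ℕ, ρ {s | Φ s = 0} • ∑ k ∈ Finset.range n, excursion K Φ κ k ≤ ρ := by
    intro n
    induction n with
    | zero => simpa using Measure.zero_le ρ
    | succ n ih =>
      have h1 := bind_mono (K := K) (Measure.restrict_mono (s := {s | Φ s ≠ 0}) le_rfl ih)
      conv_rhs => rw [← hρ, bind_eq_atom_add hΦ hatom]
      rw [Finset.sum_range_succ', smul_add, add_comm]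
      refine add_le_add le_rfl (le_trans (le_of_eq ?_) h1)
      rw [Measure.restrict_smul, Measure.comp_smul]
      congr 1
      -- What remains is that killing and moving a partial sum shifts its index by one.
      clear ih h1
      induction n with
      | zero => simp
      | succ n ih =>
        rw [Finset.sum_range_succ, ih, Finset.sum_range_succ, Measure.restrict_add,
          Measure.comp_add]
        rfl
  refine Measure.le_iff.2 fun s hs => ?_
  rw [Measure.smul_apply, occupation, Measure.sum_apply _ hs, smul_eq_mul, ← ENNReal.tsum_mul_left,
    ENNReal.tsum_eq_iSup_nat]
  refine iSup_le fun n => ?_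
  have := key n s
  rw [Measure.smul_apply, Measure.finsetSum_apply, smul_eq_mul, Finset.mul_sum] at this
  exact this

/-- Level `n + 1` sends at least the fraction `η` of its mass to level `n`, so nullity climbs from
the atom to all levels. -/
lemma eq_zero_of_invariant_of_atom_null (hΦ : Measurable Φ) {η : ℝ≥0∞} (hη : η ≠ 0)
    (hreach : ∀ s n, Φ s = n + 1 → η ≤ K s {t | Φ t = n}) {ρ : Measure X}
    (hρ : ρ.bind K = ρ) (h0 : ρ {s | Φ s = 0} = 0) : ρ = 0 := by
  have hm : ∀ n, MeasurableSet {s | Φ s = n} := fun n => hΦ (measurableSet_singleton n)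
  have key : ∀ n, ρ {s | Φ s = n} = 0 := by
    intro n
    induction n with
    | zero => exact h0
    | succ n ih =>
      have h1 : η * ρ {s | Φ s = n + 1} ≤ ρ {s | Φ s = n} := by
        conv_rhs => rw [← hρ, Measure.bind_apply (hm n) K.measurable.aemeasurable]
        rw [← lintegral_indicator_const (hm (n + 1))]
        refine lintegral_mono fun s => ?_
        by_cases hs : Φ s = n + 1
        · simpa [hs] using hreach s n hs
        · simp [hs]
      rw [ih] at h1
      simpa [hη] using h1
  rw [← Measure.measure_univ_eq_zero]
  have : (Set.univ : Set X) = ⋃ n, {s | Φ s = n} := by ext; simp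
  rw [this]
  exact measure_iUnion_null key

/-- A chain with an atom `{Φ = 0}`, negative drift of `Φ` and steps down of probability bounded
below has exactly one invariant probability measure. -/
theorem existsUnique_invariant_of_drift [IsMarkovKernel K] [IsProbabilityMeasure κ]
    (hΦ : Measurable Φ) (hatom : ∀ s, Φ s = 0 → K s = κ)
    {δ η : ℝ≥0∞} (hδ : δ ≠ 0) (hδ' : δ ≠ ∞) (hη : η ≠ 0) (hint : ∫⁻ s, Φ s ∂κ ≠ ∞)
    (hdrift : ∀ s, Φ s ≠ 0 → ∫⁻ t, Φ t ∂(K s) + δ ≤ Φ s)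
    (hreach : ∀ s n, Φ s = n + 1 → η ≤ K s {t | Φ t = n}) :
    ∃ π : Measure X, IsProbabilityMeasure π ∧ K.Invariant π ∧
      ∀ π' : Measure X, IsProbabilityMeasure π' → K.Invariant π' → π' = π := by
  have hfin := tsum_excursion_ne_zero_ne_top (K := K) hΦ hδ hδ' hint hdrift
  have hinv := occupation_invariant hΦ hatom hfin
  set G := occupation K Φ κ with hG
  have hG0 : G Set.univ ≠ 0 := by rw [hG, occupation_univ]; simp
  have hG1 : G Set.univ ≠ ∞ := by rw [hG, occupation_univ]; simpa using hfin
  have : IsFiniteMeasure G := ⟨hG1.lt_top⟩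
  refine ⟨(G Set.univ)⁻¹ • G, ⟨?_⟩, ?_, ?_⟩
  · simp [ENNReal.inv_mul_cancel hG0 hG1]
  · rw [Kernel.Invariant, Measure.comp_smul, hinv]
  intro ρ hρ hρi
  rw [Kernel.Invariant] at hρi
  have hm0 : MeasurableSet {s | Φ s = 0} := hΦ (measurableSet_singleton 0)
  have hle : ρ {s | Φ s = 0} • G ≤ ρ := smul_occupation_le hΦ hatom hρi
  set c := ρ {s | Φ s = 0} with hc
  have hcfin : c ≠ ∞ := measure_ne_top _ _
  have : IsFiniteMeasure (c • G) := Measure.smul_finite G hcfin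
  have hsub := Measure.sub_add_cancel_of_le hle
  -- The difference of two finite invariant measures is invariant. It misses the atom, to which `G`
  -- gives mass `1` and `ρ` gives mass `c`, so it vanishes.
  have hτi : (ρ - c • G).bind K = ρ - c • G := by
    have h2 : (c • G).bind K = c • G := by rw [Measure.comp_smul, hinv]
    have h1 : (ρ - c • G).bind K + c • G = (ρ - c • G) + c • G := by
      nth_rw 2 [← h2]
      rw [← Measure.comp_add, hsub, hρi]
    exact (Measure.add_left_inj _ _ _).1 h1
  have hτ0 : (ρ - c • G) {s | Φ s = 0} = 0 := by
    rw [Measure.sub_apply hm0 hle, Measure.smul_apply,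
      occupation_atom hΦ hfin, ← hc]
    simp
  have hz := eq_zero_of_invariant_of_atom_null hΦ hη hreach hτi hτ0
  rw [hz, zero_add] at hsub
  have h1 : c * G Set.univ = 1 := by
    rw [← smul_eq_mul, ← Measure.smul_apply, hsub, measure_univ]
  rw [← hsub, ENNReal.eq_inv_of_mul_eq_one_left h1]

end Atom

/-! ### Counting packets -/

instance {α : Type*} [MeasurableSpace α] [MeasurableSingletonClass α] :
    MeasurableSingletonClass (Outcome α) := measurableSingletonClass_outcome

@[simp] lemma Outcome.map_map {α β γ : Type*} (g : β → γ) (h : α → β) (o : Outcome α) :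
    (o.map h).map g = o.map fun x => g (h x) := by
  rcases o with _ | _ | _ <;> rfl

@[simp] lemma Outcome.map_id {α : Type*} (o : Outcome α) : (o.map fun x => x) = o := by
  rcases o with _ | _ | _ <;> rfl

variable {L : ℕ}

/-- The number of waiting packets of age at least `t`. -/
def load (t : ℕ) (w : Contents L) : ℕ := ∑ l, ((w l).filter (t ≤ ·)).card

/-- Indicator of the delivery of a packet of age at least `t`. -/
def delivered (t : ℕ) : Outcome (Fin L × ℕ) → ℕ
  | Sum.inr (Sum.inr (_, a)) => if t ≤ a then 1 else 0
  | _ => 0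

/-- The number of samples taken in a slot. -/
def arrivals (A : Fin L → Bool) : ℕ := ∑ l, if A l = true then 1 else 0

/-- The outcome concerns a packet that is really there. -/
def Admissible (w : Contents L) : Outcome (Fin L × ℕ) → Prop
  | Sum.inr (Sum.inr (u, a)) => a ∈ w u
  | _ => True

/-- The selection picks members of the given sets. -/
def IsValid (ξ : SlotNoise L) : Prop := ∀ s, ξ.2.1 s ∈ s.1

lemma admissible_attempt {d : Finset ℕ → ℕ} (hd : ∀ s : Finset ℕ, s.Nonempty → d s ∈ s)
    (w : Contents L) {ξ : SlotNoise L} (hξ : IsValid ξ) : Admissible w (attempt d w ξ) := by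
  unfold attempt
  split_ifs with h h'
  · have := hξ ⟨active w, h⟩
    simp only [active, Finset.mem_filter, Finset.mem_univ, true_and] at this
    exact hd _ this
  · trivial
  · trivial

lemma load_depart (t : ℕ) (w : Contents L) {o : Outcome (Fin L × ℕ)} (ho : Admissible w o) :
    load t (depart w o) + delivered t o = load t w := by
  rcases o with _ | _ | ⟨u, a⟩
  · rfl
  · rfl
  · simp only [depart, delivered, load]
    rw [← Finset.add_sum_erase _ _ (Finset.mem_univ u),
      ← Finset.add_sum_erase (a := u) Finset.univ (fun l => ((w l).filter (t ≤ ·)).card)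
        (Finset.mem_univ u)]
    have h1 : ∑ x ∈ Finset.univ.erase u,
        ((Function.update w u ((w u).erase a) x).filter (t ≤ ·)).card
        = ∑ x ∈ Finset.univ.erase u, ((w x).filter (t ≤ ·)).card := by
      refine Finset.sum_congr rfl fun x hx => ?_
      rw [Function.update_of_ne (Finset.ne_of_mem_erase hx)]
    rw [h1, Function.update_self, add_right_comm]
    congr 1
    have ha : a ∈ w u := ho
    rw [Finset.filter_erase]
    split_ifs with h
    · exact Finset.card_erase_add_one (Finset.mem_filter.2 ⟨ha, h⟩)
    · rw [Finset.erase_eq_of_notMem (by simp [h]), add_zero]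

/-- Ageing moves the threshold from `t` to `t + 1`, and new samples have age `0`, below it. -/
lemma load_advance_succ (t : ℕ) (w : Contents L) (o : Outcome (Fin L × ℕ)) (A : Fin L → Bool) :
    load (t + 1) (advance w o A) = load t (depart w o) := by
  refine Finset.sum_congr rfl fun l _ => ?_
  rw [← Finset.card_image_of_injective ((depart w o l).filter (t ≤ ·)) Nat.succ_injective]
  congr 1
  ext x
  simp only [advance, Finset.mem_filter, Finset.mem_union, Finset.mem_image]
  constructor
  · rintro ⟨⟨a, ha, rfl⟩ | h, h'⟩
    · exact ⟨a, ⟨ha, by omega⟩, rfl⟩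
    · split_ifs at h <;> simp at h
      omega
  · rintro ⟨a, ⟨ha, h⟩, rfl⟩
    exact ⟨Or.inl ⟨a, ha, rfl⟩, by omega⟩

lemma load_advance_zero (w : Contents L) (o : Outcome (Fin L × ℕ)) (A : Fin L → Bool) :
    load 0 (advance w o A) = load 0 (depart w o) + arrivals A := by
  simp only [load, arrivals, ← Finset.sum_add_distrib]
  refine Finset.sum_congr rfl fun l _ => ?_
  simp only [Nat.zero_le, Finset.filter_true, advance]
  rw [Finset.card_union_of_disjoint, Finset.card_image_of_injective _ Nat.succ_injective]
  · split_ifs <;> simp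
  · rw [Finset.disjoint_left]
    intro x hx hx'
    split_ifs at hx' <;> simp at hx hx'
    omega

lemma arrivals_le (A : Fin L → Bool) : arrivals A ≤ L := by
  refine (Finset.sum_le_card_nsmul _ _ 1 fun l _ => ?_).trans (by simp)
  split_ifs <;> simp

lemma load_zero_eq_zero {w : Contents L} : load 0 w = 0 ↔ w = fun _ => ∅ := by
  simp [load, funext_iff]

lemma queueLength_eq_zero {w : Contents L} : queueLength w = 0 ↔ load 0 w = 0 := by
  simp [load, funext_iff, queueLength]

lemma active_nonempty {w : Contents L} : (active w).Nonempty ↔ load 0 w ≠ 0 := by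
  rw [Ne, ← queueLength_eq_zero, ← not_iff_not, not_not, Finset.not_nonempty_iff_eq_empty]
  simp [active, queueLength, Finset.filter_eq_empty_iff, funext_iff]

lemma delivered_zero_attempt (d : Finset ℕ → ℕ) (w : Contents L) (ξ : SlotNoise L) :
    delivered 0 (attempt d w ξ) = if load 0 w ≠ 0 ∧ ξ.2.2 = true then 1 else 0 := by
  unfold attempt
  by_cases h : (active w).Nonempty
  · have h' := active_nonempty.1 h
    by_cases hb : ξ.2.2 = true <;> simp [h, h', hb, delivered]
  · have h' := mt active_nonempty.2 h
    simp only [h, h', delivered, dite_false, false_and, if_false]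

lemma attempt_cases (d : Finset ℕ → ℕ) (w : Contents L) (ξ : SlotNoise L) :
    (load 0 w = 0 ∧ attempt d w ξ = Sum.inl ()) ∨
    (load 0 w ≠ 0 ∧ ξ.2.2 = false ∧ attempt d w ξ = Sum.inr (Sum.inl ())) ∨
    (load 0 w ≠ 0 ∧ ξ.2.2 = true ∧ ∃ x, attempt d w ξ = Sum.inr (Sum.inr x)) := by
  unfold attempt
  by_cases h : (active w).Nonempty
  · have h' := active_nonempty.1 h
    cases hb : ξ.2.2 <;> simp [h, h']
  · have h' := mt active_nonempty.2 h
    exact Or.inl ⟨not_not.1 h', dif_neg h⟩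

lemma load_step {d : Finset ℕ → ℕ} (hd : ∀ s : Finset ℕ, s.Nonempty → d s ∈ s)
    (w : Contents L) {ξ : SlotNoise L} (hξ : IsValid ξ) :
    load 0 (advance w (attempt d w ξ) ξ.1) + delivered 0 (attempt d w ξ)
      = load 0 w + arrivals ξ.1 := by
  have := load_depart 0 w (admissible_attempt hd w hξ)
  rw [load_advance_zero]
  omega

/-- No arrivals occur in this balance. With a threshold that rises with the clock it follows the
packets of the initial contents. -/
lemma load_succ_step {d : Finset ℕ → ℕ} (hd : ∀ s : Finset ℕ, s.Nonempty → d s ∈ s)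
    (t : ℕ) (w : Contents L) {ξ : SlotNoise L} (hξ : IsValid ξ) :
    load (t + 1) (advance w (attempt d w ξ) ξ.1) + delivered t (attempt d w ξ) = load t w := by
  rw [load_advance_succ]
  exact load_depart t w (admissible_attempt hd w hξ)

/-! ### The law of a slot -/

instance (r p : I) : IsProbabilityMeasure (slotLaw L r p) := by
  unfold slotLaw
  infer_instance

/-- The law of arrivals and selections. -/
noncomputable def controlLaw (L : ℕ) (r : I) :
    Measure ((Fin L → Bool) × ({s : Finset (Fin L) // s.Nonempty} → Fin L)) :=
  (Measure.pi fun _ => bernoulliMeasure true false r).prod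
    (Measure.pi fun s : {s : Finset (Fin L) // s.Nonempty} =>
      (PMF.uniformOfFinset s.1 s.2).toMeasure)

instance (r : I) : IsProbabilityMeasure (controlLaw L r) := by
  unfold controlLaw
  infer_instance

lemma lintegral_bernoulli (p : I) (g : Bool → ℝ≥0∞) :
    ∫⁻ b, g b ∂(bernoulliMeasure true false p)
      = ENNReal.ofReal p * g true + ENNReal.ofReal (1 - p) * g false := by
  rw [bernoulliMeasure_def, lintegral_add_measure, lintegral_smul_measure, lintegral_smul_measure,
    lintegral_dirac, lintegral_dirac]
  simp only [ENNReal.smul_def, smul_eq_mul]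
  congr 2
  · rw [ENNReal.ofReal, Real.toNNReal_of_nonneg p.2.1]; rfl
  · rw [ENNReal.ofReal, Real.toNNReal_of_nonneg (sub_nonneg.2 p.2.2)]; rfl

/-- Isolates the success flag, the only part of the slot noise whose law depends on `p`. -/
lemma lintegral_slotLaw (r p : I) (g : SlotNoise L → ℝ≥0∞) :
    ∫⁻ ξ, g ξ ∂(slotLaw L r p) = ∫⁻ c, (ENNReal.ofReal p * g (c.1, c.2, true)
      + ENNReal.ofReal (1 - p) * g (c.1, c.2, false)) ∂(controlLaw L r) := by
  rw [slotLaw, controlLaw, lintegral_prod _ (by fun_prop), lintegral_prod _ (by fun_prop)]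
  refine lintegral_congr fun A => ?_
  rw [lintegral_prod _ (by fun_prop)]
  refine lintegral_congr fun s => ?_
  rw [lintegral_bernoulli]

lemma isValid_ae (r p : I) : ∀ᵐ ξ ∂(slotLaw L r p), IsValid ξ := by
  have h1 : ∀ᵐ x ∂(Measure.pi fun s : {s : Finset (Fin L) // s.Nonempty} =>
      (PMF.uniformOfFinset s.1 s.2).toMeasure), ∀ s, x s ∈ s.1 := by
    rw [ae_all_iff]
    intro s
    refine (Measure.quasiMeasurePreserving_eval (fun s : {s : Finset (Fin L) // s.Nonempty} =>
      (PMF.uniformOfFinset s.1 s.2).toMeasure) s).ae (p := fun x => x ∈ s.1) ?_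
    rw [ae_iff, PMF.toMeasure_apply_eq_zero_iff _ (Set.to_countable _).measurableSet]
    rw [Set.disjoint_left]
    intro x hx hx'
    exact hx' ((PMF.mem_support_uniformOfFinset_iff _ _).1 hx)
  exact Measure.quasiMeasurePreserving_snd.ae (Measure.quasiMeasurePreserving_fst.ae h1)

lemma map_flag_slotLaw (r p : I) :
    (slotLaw L r p).map (fun ξ => ξ.2.2) = bernoulliMeasure true false p := by
  have : (fun ξ : SlotNoise L => ξ.2.2) = Prod.snd ∘ Prod.snd := rfl
  rw [this, ← Measure.map_map (by fun_prop) (by fun_prop), slotLaw]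
  simp

lemma map_arrival_slotLaw (r p : I) (l : Fin L) :
    (slotLaw L r p).map (fun ξ => ξ.1 l) = bernoulliMeasure true false r := by
  have : (fun ξ : SlotNoise L => ξ.1 l) = Function.eval l ∘ Prod.fst := rfl
  rw [this, ← Measure.map_map (by fun_prop) (by fun_prop), slotLaw, Measure.map_fst_prod]
  simp only [measure_univ, one_smul]
  exact (measurePreserving_eval (fun _ : Fin L => bernoulliMeasure true false r) l).map_eq

lemma integral_arrivals (r p : I) :
    ∫ ξ, (arrivals ξ.1 : ℝ) ∂(slotLaw L r p) = L * r := by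
  simp only [arrivals, Nat.cast_sum]
  rw [integral_finsetSum _ fun _ _ => Integrable.of_finite]
  have h : ∀ l : Fin L, ∫ ξ, (((if ξ.1 l = true then 1 else 0 : ℕ)) : ℝ) ∂(slotLaw L r p) = r := by
    intro l
    have := integral_map (μ := slotLaw L r p) (φ := fun ξ => ξ.1 l) (by fun_prop)
      (f := fun b : Bool => (((if b = true then 1 else 0 : ℕ)) : ℝ)) (by fun_prop)
    rw [← this, map_arrival_slotLaw, integral_bernoulliMeasure]
    simp
  simp only [h]
  simp

lemma integral_flag (r p : I) (g : Bool → ℝ) :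
    ∫ ξ, g ξ.2.2 ∂(slotLaw L r p) = p * g true + (1 - p) * g false := by
  have := integral_map (μ := slotLaw L r p) (φ := fun ξ => ξ.2.2) (by fun_prop)
      (f := g) (by fun_prop)
  rw [← this, map_flag_slotLaw, integral_bernoulliMeasure]
  simp

lemma flag_ae {r p : I} (hp : p = 1) : ∀ᵐ ξ ∂(slotLaw L r p), ξ.2.2 = true := by
  have h : ∀ᵐ b ∂((slotLaw L r p).map (fun ξ => ξ.2.2)), b = true := by
    rw [map_flag_slotLaw, hp]
    simp
  exact ae_of_ae_map (by fun_prop) h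

/-- Without arrivals and with a successful flag a positive `postLoad` drops by exactly one; this
probability serves as `η`. -/
lemma quiet_success_ne_zero {r p : I} (hr : (r : ℝ) < 1) (hp : (0 : ℝ) < p) :
    slotLaw L r p {ξ | (ξ.1 = fun _ => false) ∧ ξ.2.2 = true} ≠ 0 := by
  have : {ξ : SlotNoise L | (ξ.1 = fun _ => false) ∧ ξ.2.2 = true}
      = (Set.univ.pi fun _ => {false}) ×ˢ (Set.univ ×ˢ {true}) := by
    ext ξ; simp [funext_iff, Set.mem_pi]
  rw [this, slotLaw, Measure.prod_prod, Measure.prod_prod, Measure.pi_pi]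
  simp only [measure_univ, one_mul]
  refine mul_ne_zero (Finset.prod_ne_zero_iff.2 fun l _ => ?_) ?_
  · have := lintegral_bernoulli r (Set.indicator {false} 1)
    rw [lintegral_indicator_one (by simp)] at this
    rw [this]
    simpa using hr
  · have := lintegral_bernoulli p (Set.indicator {true} 1)
    rw [lintegral_indicator_one (by simp)] at this
    rw [this]
    simpa using hp

/-! ### The stationary distribution of the augmented chain -/

section Stationary

variable {E : Type*} [MeasurableSpace E] {L : ℕ}

/-- The number of packets that are left at the end of the slot. -/
def postLoad {E : Type*} (s : AugState L E) : ℕ :=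
  load 0 (depart s.1 (s.2.map fun y => (y.1, y.2.1)))

lemma measurable_postLoad : Measurable (postLoad : AugState L E → ℕ) := by
  have h1 : Measurable fun s : AugState L E =>
      ((s.1, s.2.map fun y => (y.1, y.2.1)) : Contents L × Outcome (Fin L × ℕ)) :=
    measurable_fst.prodMk ((measurable_outcome_map (by fun_prop)).comp measurable_snd)
  have h2 : Measurable fun c : Contents L × Outcome (Fin L × ℕ) => load 0 (depart c.1 c.2) :=
    measurable_of_countable _
  have h3 := h2.comp h1
  exact h3

lemma measurable_chainStep_right (d : Finset ℕ → ℕ) (s : AugState L E) :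
    Measurable (chainStep d s) := by
  have h := (measurable_chainStep (E := E) d).comp (measurable_prodMk_left (x := s))
  exact h

instance (d : Finset ℕ → ℕ) (r p : I) (f : Measure E) [IsProbabilityMeasure f] :
    IsMarkovKernel (augKernel (L := L) d r p f) := by
  unfold augKernel
  exact Kernel.IsMarkovKernel.map _ (measurable_chainStep d)

lemma augKernel_apply (d : Finset ℕ → ℕ) (r p : I) (f : Measure E) [IsProbabilityMeasure f]
    (s : AugState L E) :
    augKernel d r p f s = ((slotLaw L r p).prod f).map (chainStep d s) := by
  rw [augKernel, Kernel.map_apply _ (measurable_chainStep d), Kernel.prod_apply, Kernel.id_apply,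
    Kernel.const_apply, Measure.dirac_prod, Measure.map_map (measurable_chainStep d) (by fun_prop)]
  rfl

lemma isValid_prod_ae (r p : I) (f : Measure E) [IsProbabilityMeasure f] :
    ∀ᵐ x ∂((slotLaw L r p).prod f), IsValid x.1 :=
  Measure.quasiMeasurePreserving_fst.ae (isValid_ae r p)

lemma load_chainStep {E : Type*} (d : Finset ℕ → ℕ) (s : AugState L E) (x : SlotNoise L × E) :
    load 0 (chainStep d s x).1 = postLoad s + arrivals x.1.1 :=
  load_advance_zero _ _ _

lemma postLoad_chainStep {E : Type*} {d : Finset ℕ → ℕ} (hd : ∀ s : Finset ℕ, s.Nonempty → d s ∈ s)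
    (s : AugState L E) {x : SlotNoise L × E} (hx : IsValid x.1) :
    postLoad (chainStep d s x) + (if postLoad s + arrivals x.1.1 ≠ 0 ∧ x.1.2.2 = true then 1 else 0)
      = postLoad s + arrivals x.1.1 := by
  have h1 := load_chainStep d s x
  have h2 := load_depart 0 (chainStep d s x).1
    (admissible_attempt hd (chainStep d s x).1 hx)
  rw [delivered_zero_attempt, h1] at h2
  refine Eq.trans (congrArg₂ (· + ·) ?_ rfl) h2
  simp only [postLoad, chainStep, Outcome.map_map, Prod.mk.eta, Outcome.map_id]

lemma chainStep_eq_of_postLoad_eq_zero {E : Type*} (d : Finset ℕ → ℕ) {s t : AugState L E}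
    (hs : postLoad s = 0) (ht : postLoad t = 0) : chainStep d s = chainStep d t := by
  rw [postLoad, load_zero_eq_zero] at hs ht
  have h : ∀ A, advance s.1 (s.2.map fun y => (y.1, y.2.1)) A
      = advance t.1 (t.2.map fun y => (y.1, y.2.1)) A := fun A => by
    funext l
    simp only [advance, hs, ht]
  funext x
  simp only [chainStep, h]

theorem existsUnique_invariant_augKernel {r p : I} (hr : (r : ℝ) < 1) (hstable : (L : ℝ) * r < p)
    {d : Finset ℕ → ℕ} (hd : ∀ s : Finset ℕ, s.Nonempty → d s ∈ s)
    (f : Measure E) [IsProbabilityMeasure f] :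
    ∃ π : Measure (AugState L E), IsProbabilityMeasure π ∧ (augKernel d r p f).Invariant π ∧
      ∀ π' : Measure (AugState L E), IsProbabilityMeasure π' →
        (augKernel d r p f).Invariant π' → π' = π := by
  have hp : (0 : ℝ) < p := lt_of_le_of_lt (mul_nonneg (Nat.cast_nonneg _) r.2.1) hstable
  let s₀ : AugState L E := (fun _ => ∅, Sum.inl ())
  have hs₀ : postLoad s₀ = 0 := load_zero_eq_zero.2 rfl
  have hpost : Measurable (postLoad : AugState L E → ℕ) := measurable_postLoad
  have hcast : Measurable fun s : AugState L E => (postLoad s : ℝ≥0∞) := by fun_prop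
  have hle : ∀ s : AugState L E, ∀ᵐ x ∂((slotLaw L r p).prod f),
      postLoad (chainStep d s x) ≤ postLoad s + L := by
    intro s
    filter_upwards [isValid_prod_ae r p f] with x hx
    have := postLoad_chainStep hd s hx
    have := arrivals_le x.1.1
    omega
  refine existsUnique_invariant_of_drift (Φ := postLoad) (κ := augKernel d r p f s₀)
    (δ := ENNReal.ofReal (p - L * r))
    (η := slotLaw L r p {ξ | (ξ.1 = fun _ => false) ∧ ξ.2.2 = true}) hpost ?_ ?_
    ENNReal.ofReal_ne_top (quiet_success_ne_zero hr hp) ?_ ?_ ?_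
  · intro s hs
    rw [augKernel_apply, augKernel_apply, chainStep_eq_of_postLoad_eq_zero d hs hs₀]
  · simpa using hstable
  · rw [augKernel_apply, lintegral_map hcast (measurable_chainStep_right d s₀)]
    refine ne_top_of_le_ne_top (b := (L : ℝ≥0∞)) (by simp) ?_
    calc _ ≤ ∫⁻ _, (L : ℝ≥0∞) ∂((slotLaw L r p).prod f) := lintegral_mono_ae ?_
      _ = L := by simp
    filter_upwards [hle s₀] with x hx
    rw [hs₀, zero_add] at hx
    exact_mod_cast hx
  · intro s hs
    rw [augKernel_apply, lintegral_map hcast (measurable_chainStep_right d s)]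
    have hint : Integrable (fun x => (postLoad (chainStep d s x) : ℝ)) ((slotLaw L r p).prod f) := by
      refine Integrable.of_bound
        (measurable_from_top.comp (hpost.comp (measurable_chainStep_right d s))).aestronglyMeasurable
        ((postLoad s + L : ℕ) : ℝ) ?_
      filter_upwards [hle s] with x hx
      rw [Real.norm_of_nonneg (Nat.cast_nonneg _)]
      exact_mod_cast hx
    have h1 : ∫⁻ x, (postLoad (chainStep d s x) : ℝ≥0∞) ∂((slotLaw L r p).prod f)
        = ENNReal.ofReal (∫ x, (postLoad (chainStep d s x) : ℝ) ∂((slotLaw L r p).prod f)) := by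
      rw [ofReal_integral_eq_lintegral_ofReal hint (ae_of_all _ fun _ => Nat.cast_nonneg _)]
      simp
    have hI : ∀ g : SlotNoise L → ℝ, ∫ x, g x.1 ∂((slotLaw L r p).prod f)
        = ∫ ξ, g ξ ∂(slotLaw L r p) := fun g => by
      rw [integral_fun_fst]; simp
    have hg : ∀ g : SlotNoise L → ℝ, Integrable (fun x : SlotNoise L × E => g x.1)
        ((slotLaw L r p).prod f) := fun g => (Integrable.of_finite (f := g)).comp_fst f
    have h2 : ∫ x, (postLoad (chainStep d s x) : ℝ) ∂((slotLaw L r p).prod f)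
        = postLoad s + L * r - p := by
      have : ∀ᵐ x ∂((slotLaw L r p).prod f), (postLoad (chainStep d s x) : ℝ)
          = (postLoad s + arrivals x.1.1) - (if x.1.2.2 = true then 1 else 0) := by
        filter_upwards [isValid_prod_ae r p f] with x hx
        have h3 := postLoad_chainStep hd s hx
        -- Off the atom the slot is busy whatever arrives, so the mean increment is exactly `L * r -
        -- p`.
        have h4 : postLoad s + arrivals x.1.1 ≠ 0 := by omega
        rw [eq_sub_iff_add_eq]
        simp only [h4, ne_eq, not_false_eq_true, true_and] at h3
        exact_mod_cast h3
      rw [integral_congr_ae this, integral_sub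
        (hg fun ξ => postLoad s + arrivals ξ.1) (hg fun ξ => if ξ.2.2 = true then 1 else 0),
        integral_add (integrable_const _) (hg fun ξ => arrivals ξ.1),
        hI (fun ξ => arrivals ξ.1), hI (fun ξ => if ξ.2.2 = true then 1 else 0),
        integral_arrivals, integral_flag r p fun b => if b = true then 1 else 0]
      simp
    have h0 : 0 ≤ (postLoad s : ℝ) + L * r - p := by
      rw [← h2]; exact integral_nonneg fun _ => Nat.cast_nonneg _
    rw [h1, h2, ← ENNReal.ofReal_add h0 (by linarith)]
    rw [← ENNReal.ofReal_natCast]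
    exact ENNReal.ofReal_le_ofReal (by linarith)
  · intro s n hs
    have hm : MeasurableSet {t : AugState L E | postLoad t = n} :=
      measurable_postLoad (measurableSet_singleton n)
    rw [augKernel_apply, Measure.map_apply (measurable_chainStep_right d s) hm]
    have h1 : ((slotLaw L r p).prod f)
        ({ξ | (ξ.1 = fun _ => false) ∧ ξ.2.2 = true} ×ˢ Set.univ)
        = slotLaw L r p {ξ | (ξ.1 = fun _ => false) ∧ ξ.2.2 = true} := by
      rw [Measure.prod_prod]; simp
    rw [← h1]
    refine measure_mono_ae ?_
    filter_upwards [isValid_prod_ae r p f] with x hx hx'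
    have h3 := postLoad_chainStep hd s hx
    obtain ⟨⟨h4, h5⟩, -⟩ := hx'
    have h6 : arrivals x.1.1 = 0 := by simp [h4, arrivals]
    rw [h5, h6, hs] at h3
    simp at h3
    exact h3

/-! ### Rates and expectations under a stationary law. -/

section Rates

variable {r p : I} {d : Finset ℕ → ℕ} {f : Measure E} [IsProbabilityMeasure f]
  {π : Measure (AugState L E)}

/-- Writes a stationary state as one step from a stationary state with independent noise. Stationary
expectations then become integrals over a product, where independence is available. -/
lemma map_chainStep_of_invariant [SFinite π] (hπ : (augKernel d r p f).Invariant π) :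
    (π.prod ((slotLaw L r p).prod f)).map (fun y => chainStep d y.1 y.2) = π := by
  conv_rhs => rw [← hπ.def]
  ext s hs
  rw [Measure.map_apply (measurable_chainStep d) hs,
    Measure.prod_apply (measurable_chainStep d hs),
    Measure.bind_apply hs (Kernel.measurable _).aemeasurable]
  refine lintegral_congr fun t => ?_
  rw [augKernel_apply, Measure.map_apply (measurable_chainStep_right d t) hs]
  rfl

lemma integral_chainStep_of_invariant [SFinite π] (hπ : (augKernel d r p f).Invariant π) {g : AugState L E → ℝ}
    (hg : Measurable g) :
    ∫ y, g (chainStep d y.1 y.2) ∂(π.prod ((slotLaw L r p).prod f)) = ∫ s, g s ∂π := by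
  conv_rhs => rw [← map_chainStep_of_invariant hπ]
  rw [integral_map (measurable_chainStep d).aemeasurable hg.aestronglyMeasurable]

/-- In the stationary regime, a function with bounded increments does not drift. -/
lemma integral_increment_eq_zero [IsProbabilityMeasure π] (hπ : (augKernel d r p f).Invariant π) {g : AugState L E → ℕ}
    (hg : Measurable g) {C : ℝ}
    (hC : ∀ᵐ y ∂(π.prod ((slotLaw L r p).prod f)),
      |(g (chainStep d y.1 y.2) : ℝ) - g y.1| ≤ C) :
    ∫ y, ((g (chainStep d y.1 y.2) : ℝ) - g y.1) ∂(π.prod ((slotLaw L r p).prod f)) = 0 := by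
  have hstep := measurable_chainStep (E := E) (L := L) d
  -- Since `g` is not assumed integrable it is truncated at `M`. Truncation does not enlarge
  -- increments, so `C` dominates them as `M → ∞`.
  have h1 : ∀ M : ℕ, ∫ y, (((min (g (chainStep d y.1 y.2)) M : ℕ) : ℝ) - (min (g y.1) M : ℕ))
      ∂(π.prod ((slotLaw L r p).prod f)) = 0 := by
    intro M
    have hb : ∀ h : AugState L E × (SlotNoise L × E) → ℕ, Measurable h →
        Integrable (fun y => ((min (h y) M : ℕ) : ℝ)) (π.prod ((slotLaw L r p).prod f)) := by
      intro h hh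
      refine Integrable.of_bound (by fun_prop) (M : ℝ) (ae_of_all _ fun y => ?_)
      rw [Real.norm_of_nonneg (Nat.cast_nonneg _)]
      exact_mod_cast min_le_right _ _
    rw [integral_sub (hb (fun y => g (chainStep d y.1 y.2)) (hg.comp hstep))
      (hb (fun y => g y.1) (by fun_prop)),
      integral_chainStep_of_invariant hπ (g := fun s => ((min (g s) M : ℕ) : ℝ)) (by fun_prop),
      integral_fun_fst (fun s => ((min (g s) M : ℕ) : ℝ))]
    simp
  have h2 : Tendsto (fun M : ℕ => ∫ y, (((min (g (chainStep d y.1 y.2)) M : ℕ) : ℝ)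
      - (min (g y.1) M : ℕ)) ∂(π.prod ((slotLaw L r p).prod f))) atTop
      (𝓝 (∫ y, ((g (chainStep d y.1 y.2) : ℝ) - g y.1) ∂(π.prod ((slotLaw L r p).prod f)))) := by
    refine tendsto_integral_of_dominated_convergence (fun _ => C) (fun M => ?_)
      (integrable_const _) (fun M => ?_) (ae_of_all _ fun y => ?_)
    · have h : Measurable fun n : ℕ => ((min n M : ℕ) : ℝ) := measurable_from_top
      exact ((h.comp (hg.comp hstep)).sub (h.comp (hg.comp measurable_fst))).aestronglyMeasurable
    · filter_upwards [hC] with y hy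
      refine le_trans ?_ hy
      rw [Real.norm_eq_abs]
      push_cast
      exact (abs_min_sub_min_le_max _ _ _ _).trans (by simp)
    · refine tendsto_const_nhds.congr' ?_
      filter_upwards [eventually_ge_atTop (g (chainStep d y.1 y.2)), eventually_ge_atTop (g y.1)]
        with M h h'
      rw [min_eq_left h, min_eq_left h']
  simp only [h1] at h2
  exact tendsto_nhds_unique h2 tendsto_const_nhds

lemma chainStep_cases {E : Type*} (d : Finset ℕ → ℕ) (s : AugState L E) (x : SlotNoise L × E) :
    ∃ w : Contents L, load 0 w = postLoad s + arrivals x.1.1 ∧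
    ((postLoad s + arrivals x.1.1 = 0 ∧ chainStep d s x = (w, Sum.inl ())) ∨
    (postLoad s + arrivals x.1.1 ≠ 0 ∧ x.1.2.2 = false ∧
      chainStep d s x = (w, Sum.inr (Sum.inl ()))) ∨
    (postLoad s + arrivals x.1.1 ≠ 0 ∧ x.1.2.2 = true ∧
      ∃ y : Fin L × ℕ, chainStep d s x = (w, Sum.inr (Sum.inr (y.1, y.2, x.2))))) := by
  have h1 := load_chainStep d s x
  refine ⟨(chainStep d s x).1, h1, ?_⟩
  have h2 := attempt_cases d (chainStep d s x).1 x.1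
  rw [h1] at h2
  have h3 : chainStep d s x = ((chainStep d s x).1,
    (attempt d (chainStep d s x).1 x.1).map fun y => (y.1, y.2, x.2)) := rfl
  rcases h2 with ⟨h, h'⟩ | ⟨h, hb, h'⟩ | ⟨h, hb, y, h'⟩ <;> rw [h'] at h3
  · exact Or.inl ⟨h, h3⟩
  · exact Or.inr (Or.inl ⟨h, hb, h3⟩)
  · exact Or.inr (Or.inr ⟨h, hb, y, h3⟩)

/-- Indicator of the event that some queue is nonempty after a step of the chain. -/
noncomputable def busyIndicator {E : Type*} (y : AugState L E × (SlotNoise L × E)) : ℝ :=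
  if postLoad y.1 + arrivals y.2.1.1 ≠ 0 then 1 else 0

lemma measurable_busyIndicator :
    Measurable (busyIndicator : AugState L E × (SlotNoise L × E) → ℝ) := by
  have h1 : Measurable fun y : AugState L E × (SlotNoise L × E) =>
      postLoad y.1 + arrivals y.2.1.1 := by
    have h2 : Measurable fun y : AugState L E × (SlotNoise L × E) => postLoad y.1 :=
      measurable_postLoad.comp measurable_fst
    have h3 : Measurable fun y : AugState L E × (SlotNoise L × E) => arrivals y.2.1.1 :=
      (measurable_of_countable fun ξ : SlotNoise L => arrivals ξ.1).comp
        (measurable_fst.comp measurable_snd)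
    exact h2.add h3
  have h4 : Measurable fun n : ℕ => if n ≠ 0 then (1 : ℝ) else 0 := measurable_from_top
  have h5 := h4.comp h1
  exact h5

lemma busyIndicator_eq {E : Type*} (d : Finset ℕ → ℕ) (y : AugState L E × (SlotNoise L × E)) :
    busyIndicator y = {s : AugState L E | queueLength s.1 ≠ 0}.indicator 1 (chainStep d y.1 y.2) := by
  rcases chainStep_cases d y.1 y.2 with ⟨w, hw, ⟨h, h'⟩ | ⟨h, -, h'⟩ | ⟨h, -, x, h'⟩⟩ <;>
    simp [busyIndicator, Set.indicator, queueLength_eq_zero, hw, h, h', -Nat.add_eq_zero_iff,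
      -add_eq_zero]

lemma measurableSet_busy : MeasurableSet {s : AugState L E | queueLength s.1 ≠ 0} :=
  measurable_fst (Set.to_countable {w : Contents L | queueLength w ≠ 0}).measurableSet

lemma integrable_busy_mul [IsProbabilityMeasure π] (k : Bool → ℝ) {ℓ : E → ℝ}
    (hℓ : Integrable ℓ f) :
    Integrable (fun y => busyIndicator y * (k y.2.1.2.2 * ℓ y.2.2))
      (π.prod ((slotLaw L r p).prod f)) := by
  have h1 : Integrable (fun x : SlotNoise L × E => k x.1.2.2 * ℓ x.2) ((slotLaw L r p).prod f) :=
    Integrable.mul_prod (f := fun ξ : SlotNoise L => k ξ.2.2) Integrable.of_finite hℓ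
  refine (h1.comp_snd π).bdd_mul (c := 1) measurable_busyIndicator.aestronglyMeasurable
    (ae_of_all _ fun y => ?_)
  unfold busyIndicator
  split_ifs <;> simp

/-- The busy indicator depends on the previous state and the arrivals only, and these are
independent of the success flag and of the measurement. -/
lemma integral_busy_mul [IsProbabilityMeasure π] (hπ : (augKernel d r p f).Invariant π)
    (k : Bool → ℝ) {ℓ : E → ℝ} (hℓ : Integrable ℓ f) :
    ∫ y, busyIndicator y * (k y.2.1.2.2 * ℓ y.2.2) ∂(π.prod ((slotLaw L r p).prod f))
      = π.real {s | queueLength s.1 ≠ 0} * ((p * k true + (1 - p) * k false) * ∫ z, ℓ z ∂f) := by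
  have key : ∀ (k : Bool → ℝ) {ℓ : E → ℝ}, Integrable ℓ f →
      ∫ y, busyIndicator y * (k y.2.1.2.2 * ℓ y.2.2) ∂(π.prod ((slotLaw L r p).prod f))
      = (∫ s, (∫ A, (if postLoad s + arrivals A ≠ 0 then (1 : ℝ) else 0)
          ∂(Measure.pi fun _ : Fin L => bernoulliMeasure true false r)) ∂π)
        * ((p * k true + (1 - p) * k false) * ∫ z, ℓ z ∂f) := by
    intro k ℓ hℓ
    rw [integral_prod _ (integrable_busy_mul k hℓ), ← integral_mul_const]
    refine integral_congr_ae (ae_of_all _ fun s => ?_)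
    simp only [busyIndicator, ← mul_assoc]
    rw [integral_prod_mul (fun ξ : SlotNoise L =>
      (if postLoad s + arrivals ξ.1 ≠ 0 then (1 : ℝ) else 0) * k ξ.2.2) ℓ]
    congr 1
    rw [slotLaw, integral_prod_mul (fun A : Fin L → Bool =>
      if postLoad s + arrivals A ≠ 0 then (1 : ℝ) else 0)
      (fun c : ({s : Finset (Fin L) // s.Nonempty} → Fin L) × Bool => k c.2)]
    congr 1
    rw [integral_fun_snd, integral_bernoulliMeasure]
    simp
  -- The choice `k = ℓ = 1` identifies the first factor as the stationary busy probability.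
  have h1 := key (fun _ => 1) (ℓ := fun _ => 1) (integrable_const _)
  have h2 : ∫ y, busyIndicator y * (1 * 1) ∂(π.prod ((slotLaw L r p).prod f))
      = π.real {s | queueLength s.1 ≠ 0} := by
    simp only [mul_one, busyIndicator_eq d]
    rw [integral_chainStep_of_invariant hπ
      (measurable_one.indicator measurableSet_busy), integral_indicator_one measurableSet_busy]
  rw [key k hℓ, ← h2, h1]
  simp

lemma isSuccess_chainStep {E : Type*} {d : Finset ℕ → ℕ} (y : AugState L E × (SlotNoise L × E)) :
    {s : AugState L E | s.2.IsSuccess}.indicator 1 (chainStep d y.1 y.2)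
      = busyIndicator y * ((if y.2.1.2.2 = true then 1 else 0) * 1) := by
  rcases chainStep_cases d y.1 y.2 with ⟨w, hw, ⟨h, h'⟩ | ⟨h, hb, h'⟩ | ⟨h, hb, x, h'⟩⟩ <;>
    rw [h', busyIndicator] <;>
    simp only [h, Set.indicator, Set.mem_ofPred_eq, Outcome.IsSuccess] <;> simp [*]
  omega

lemma measurableSet_isSuccess : MeasurableSet {s : AugState L E | s.2.IsSuccess} := by
  have h : {s : AugState L E | s.2.IsSuccess}
      = (fun s => s.2.map fun _ => ()) ⁻¹' {Sum.inr (Sum.inr ())} := by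
    ext ⟨w, o⟩
    rcases o with _ | _ | _ <;> simp [Outcome.map, Outcome.IsSuccess]
  rw [h]
  exact ((measurable_outcome_map measurable_const).comp measurable_snd)
    (measurableSet_singleton _)

lemma stationary_success [IsProbabilityMeasure π] (hπ : (augKernel d r p f).Invariant π) :
    π.real {s | s.2.IsSuccess} = π.real {s | queueLength s.1 ≠ 0} * p := by
  have h := integral_busy_mul hπ (fun b => if b = true then 1 else 0) (ℓ := fun _ => 1)
    (integrable_const _)
  simp only [← isSuccess_chainStep (d := d)] at h
  rw [integral_chainStep_of_invariant hπ (measurable_one.indicator measurableSet_isSuccess),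
    integral_indicator_one measurableSet_isSuccess] at h
  simpa using h

/-- In the stationary regime the departure rate is the arrival rate. -/
lemma stationary_rate [IsProbabilityMeasure π] (hπ : (augKernel d r p f).Invariant π)
    (hd : ∀ s : Finset ℕ, s.Nonempty → d s ∈ s) :
    π.real {s | s.2.IsSuccess} = L * r := by
  have hae : ∀ᵐ y ∂(π.prod ((slotLaw L r p).prod f)),
      (postLoad (chainStep d y.1 y.2) : ℝ) - postLoad y.1
        = arrivals y.2.1.1
          - {s : AugState L E | s.2.IsSuccess}.indicator 1 (chainStep d y.1 y.2) := by
    filter_upwards [Measure.quasiMeasurePreserving_snd.ae (isValid_prod_ae r p f)] with y hy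
    have h1 := postLoad_chainStep hd y.1 hy
    rw [isSuccess_chainStep]
    have h2 : (postLoad (chainStep d y.1 y.2) : ℝ)
        + ((if postLoad y.1 + arrivals y.2.1.1 ≠ 0 ∧ y.2.1.2.2 = true then 1 else 0 : ℕ) : ℝ)
          = postLoad y.1 + arrivals y.2.1.1 := by exact_mod_cast h1
    have h3 : busyIndicator y * ((if y.2.1.2.2 = true then 1 else 0) * 1)
        = ((if postLoad y.1 + arrivals y.2.1.1 ≠ 0 ∧ y.2.1.2.2 = true then 1 else 0 : ℕ) : ℝ) := by
      unfold busyIndicator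
      split_ifs <;> simp_all
    rw [h3]
    linarith
  have h0 := integral_increment_eq_zero hπ measurable_postLoad (C := L + 1) (by
    filter_upwards [hae] with y hy
    rw [hy]
    have h1 : (arrivals y.2.1.1 : ℝ) ≤ L := by exact_mod_cast arrivals_le _
    have h2 : (0 : ℝ) ≤ arrivals y.2.1.1 := Nat.cast_nonneg _
    have h3 : (0 : ℝ) ≤ L := Nat.cast_nonneg _
    rw [abs_le]
    by_cases h : chainStep d y.1 y.2 ∈ {s : AugState L E | s.2.IsSuccess}
    · rw [Set.indicator_of_mem h, Pi.one_apply]; constructor <;> linarith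
    · rw [Set.indicator_of_notMem h]; constructor <;> linarith)
  have hstep := measurable_chainStep (E := E) (L := L) d
  have hA : Integrable (fun y : AugState L E × (SlotNoise L × E) => (arrivals y.2.1.1 : ℝ))
      (π.prod ((slotLaw L r p).prod f)) :=
    ((Integrable.of_finite (f := fun ξ : SlotNoise L => (arrivals ξ.1 : ℝ))).comp_fst f).comp_snd π
  have hS : Measurable ({s : AugState L E | s.2.IsSuccess}.indicator (1 : AugState L E → ℝ)) :=
    measurable_one.indicator measurableSet_isSuccess
  rw [integral_congr_ae hae, integral_sub hA, integral_chainStep_of_invariant hπ hS,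
    integral_indicator_one measurableSet_isSuccess,
    integral_fun_snd (fun x : SlotNoise L × E => (arrivals x.1.1 : ℝ)),
    integral_fun_fst (fun ξ : SlotNoise L => (arrivals ξ.1 : ℝ)), integral_arrivals] at h0
  · simp at h0
    linarith
  · refine Integrable.of_bound (hS.comp hstep).aestronglyMeasurable 1 (ae_of_all _ fun y => ?_)
    simp only [Set.indicator]
    split_ifs <;> simp

lemma measurable_slotLLR (p₀ p₁ : I) (f₀ f₁ : Measure E) :
    Measurable (slotLLR p₀ p₁ f₀ f₁ : AugState L E → ℝ) := by
  have h1 : ∀ q : I, Measurable (channelProb q : Outcome (Fin L × ℕ × E) → ℝ) := fun q =>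
    measurable_fun_sum measurable_const (measurable_fun_sum measurable_const measurable_const)
  have h2 : Measurable (measurementLLR f₀ f₁ : Outcome (Fin L × ℕ × E) → ℝ) :=
    measurable_fun_sum measurable_const (measurable_fun_sum measurable_const
      ((measurable_llr f₁ f₀).comp (measurable_snd.comp measurable_snd)))
  exact ((Real.measurable_log.comp (((h1 p₁).comp measurable_snd).div
    ((h1 p₀).comp measurable_snd))).indicator measurableSet_busy).add (h2.comp measurable_snd)

lemma slotLLR_chainStep (p₀ p₁ : I) (f₀ f₁ : Measure E) (y : AugState L E × (SlotNoise L × E)) :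
    slotLLR p₀ p₁ f₀ f₁ (chainStep d y.1 y.2)
      = busyIndicator y * ((if y.2.1.2.2 = true then Real.log (p₁ / p₀)
          else Real.log ((1 - p₁) / (1 - p₀))) * 1)
        + busyIndicator y * ((if y.2.1.2.2 = true then 1 else 0) * llr f₁ f₀ y.2.2) := by
  rcases chainStep_cases d y.1 y.2 with ⟨w, hw, ⟨h, h'⟩ | ⟨h, hb, h'⟩ | ⟨h, hb, x, h'⟩⟩ <;>
    rw [h', busyIndicator] <;>
    simp only [h, slotLLR, Set.indicator, Set.mem_ofPred_eq, channelProb, measurementLLR, ne_eq,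
      queueLength_eq_zero, hw] <;> simp [*]

lemma integrable_slotLLR [IsProbabilityMeasure π] {p₀ : I} {f₀ : Measure E}
    (hπ : (augKernel d r p f).Invariant π) (hf : Integrable (llr f f₀) f) :
    Integrable (slotLLR p₀ p f₀ f) π := by
  rw [← map_chainStep_of_invariant hπ, integrable_map_measure
    (measurable_slotLLR _ _ _ _).aestronglyMeasurable (measurable_chainStep d).aemeasurable]
  refine ((integrable_busy_mul (fun b => if b = true then Real.log (p / p₀)
    else Real.log ((1 - p) / (1 - p₀))) (integrable_const 1)).add
      (integrable_busy_mul (fun b => if b = true then 1 else 0) hf)).congr (ae_of_all _ fun y => ?_)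
  exact (slotLLR_chainStep p₀ p f₀ f y).symm

lemma integral_slotLLR [IsProbabilityMeasure π] {p₀ : I} {f₀ : Measure E}
    (hπ : (augKernel d r p f).Invariant π) (hf : Integrable (llr f f₀) f) :
    ∫ s, slotLLR p₀ p f₀ f s ∂π = π.real {s | queueLength s.1 ≠ 0} * klBernoulli p p₀
      + π.real {s | s.2.IsSuccess} * ∫ z, llr f f₀ z ∂f := by
  rw [← integral_chainStep_of_invariant hπ (measurable_slotLLR _ _ _ _)]
  simp only [slotLLR_chainStep]
  rw [integral_add (integrable_busy_mul (fun b => if b = true then Real.log (p / p₀)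
    else Real.log ((1 - p) / (1 - p₀))) (integrable_const 1))
    (integrable_busy_mul (fun b => if b = true then 1 else 0) hf),
    integral_busy_mul hπ (fun b => if b = true then Real.log (p / p₀)
      else Real.log ((1 - p) / (1 - p₀))) (integrable_const 1),
    integral_busy_mul hπ (fun b => if b = true then 1 else 0) hf, stationary_success hπ]
  simp [klBernoulli, mul_assoc]

end Rates

end Stationary

/-! ### Product measures -/

section Product

/-- Prepend an element to a sequence. -/
def consSeq {S : Type*} (x : S) (ξ : ℕ → S) : ℕ → S
  | 0 => x
  | n + 1 => ξ n

lemma measurable_consSeq {S : Type*} [MeasurableSpace S] :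
    Measurable fun q : S × (ℕ → S) => consSeq q.1 q.2 := by
  refine measurable_pi_iff.2 fun n => ?_
  cases n with
  | zero => exact measurable_fst
  | succ n => exact (measurable_pi_apply n).comp measurable_snd

lemma map_consSeq_infinitePi {S : Type*} [MeasurableSpace S] (μ : Measure S)
    [IsProbabilityMeasure μ] :
    (μ.prod (Measure.infinitePi fun _ : ℕ => μ)).map (fun q => consSeq q.1 q.2)
      = Measure.infinitePi fun _ : ℕ => μ := by
  classical
  refine Measure.eq_infinitePi _ fun s t ht => ?_
  obtain ⟨N, hN⟩ : ∃ N, s ⊆ Finset.range (N + 1) :=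
    ⟨s.sup id, fun i hi => Finset.mem_range_succ_iff.2 (Finset.le_sup (f := id) hi)⟩
  -- A cylinder is padded with `univ` to one over an initial segment, so that splitting off
  -- coordinate `0` leaves an initial segment again.
  set t' : ℕ → Set S := fun i => if i ∈ s then t i else Set.univ with ht'
  have hm : ∀ i, MeasurableSet (t' i) := fun i => by
    rw [ht']; dsimp only; split_ifs
    exacts [ht i, .univ]
  have h1 : Set.pi (s : Set ℕ) t = Set.pi (Finset.range (N + 1) : Set ℕ) t' := by
    ext x
    simp only [Set.mem_pi, ht']
    constructor
    · intro h i _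
      split_ifs with hi
      exacts [h i hi, trivial]
    · intro h i hi
      have := h i (hN hi)
      rwa [if_pos (by exact hi)] at this
  have h2 : ∏ i ∈ s, μ (t i) = ∏ i ∈ Finset.range (N + 1), μ (t' i) := by
    rw [← Finset.prod_subset hN]
    · exact Finset.prod_congr rfl fun i hi => by simp [ht', hi]
    · intro i _ hi
      simp [ht', hi]
  have h3 : (fun q : S × (ℕ → S) => consSeq q.1 q.2) ⁻¹' (Set.pi (Finset.range (N + 1) : Set ℕ) t')
      = t' 0 ×ˢ Set.pi (Finset.range N : Set ℕ) fun i => t' (i + 1) := by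
    ext q
    simp only [Set.mem_preimage, Set.mem_pi, Set.mem_prod, Finset.coe_range, Set.mem_Iio]
    constructor
    · exact fun h => ⟨h 0 (by omega), fun i hi => h (i + 1) (by omega)⟩
    · rintro ⟨h, h'⟩ (_ | i) hi
      exacts [h, h' i (by omega)]
  rw [h1, h2, Measure.map_apply measurable_consSeq
    (MeasurableSet.pi (Set.to_countable _) fun i _ => hm i), h3, Measure.prod_prod,
    Measure.infinitePi_pi _ fun i _ => hm (i + 1), Finset.prod_range_succ', mul_comm]

/-- First-step analysis: inductions over slots split off the first slot and restart from the next
contents with i.i.d. noise. -/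
lemma lintegral_infinitePi_cons {S : Type*} [MeasurableSpace S] (μ : Measure S)
    [IsProbabilityMeasure μ] {g : (ℕ → S) → ℝ≥0∞} (hg : Measurable g) :
    ∫⁻ ξ, g ξ ∂(Measure.infinitePi fun _ : ℕ => μ)
      = ∫⁻ x, ∫⁻ ξ, g (consSeq x ξ) ∂(Measure.infinitePi fun _ : ℕ => μ) ∂μ := by
  conv_lhs => rw [← map_consSeq_infinitePi μ]
  rw [lintegral_map hg measurable_consSeq, lintegral_prod]
  exact (hg.comp measurable_consSeq).aemeasurable

variable {ι E : Type*} [MeasurableSpace E]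

lemma pi_withDensity [Fintype ι] {μ ν : ι → Measure E} [∀ i, IsProbabilityMeasure (μ i)]
    [∀ i, IsProbabilityMeasure (ν i)] {h : ι → E → ℝ≥0∞} (hh : ∀ i, Measurable (h i))
    (hν : ∀ i, ν i = (μ i).withDensity (h i)) :
    Measure.pi ν = (Measure.pi μ).withDensity fun x => ∏ i, h i (x i) := by
  refine Measure.pi_eq fun s hs => ?_
  rw [withDensity_apply _ (MeasurableSet.univ_pi hs), ← lintegral_indicator (MeasurableSet.univ_pi hs)]
  have h1 : ∀ x : ι → E, (Set.univ.pi s).indicator (fun x => ∏ i, h i (x i)) x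
      = ∏ i, (s i).indicator (h i) (x i) := by
    intro x
    by_cases hx : x ∈ Set.univ.pi s
    · rw [Set.indicator_of_mem hx]
      exact Finset.prod_congr rfl fun i _ => (Set.indicator_of_mem (hx i trivial) _).symm
    · rw [Set.indicator_of_notMem hx]
      simp only [Set.mem_pi, Set.mem_univ, true_imp_iff, not_forall] at hx
      obtain ⟨i, hi⟩ := hx
      exact (Finset.prod_eq_zero (Finset.mem_univ i) (Set.indicator_of_notMem hi _)).symm
  simp only [h1]
  have hm : ∀ i, Measurable ((s i).indicator (h i)) := fun i => (hh i).indicator (hs i)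
  rw [lintegral_prod_eq_prod_lintegral_of_indepFun Finset.univ
    (fun i (x : ι → E) => (s i).indicator (h i) (x i))
    (iIndepFun_pi fun i => (hm i).aemeasurable) fun i => (hm i).comp (measurable_pi_apply i)]
  refine Finset.prod_congr rfl fun i _ => ?_
  rw [hν i, withDensity_apply _ (hs i), ← lintegral_indicator (hs i)]
  exact (measurePreserving_eval μ i).lintegral_comp (hm i)

/-- Change of measure in finitely many coordinates of a product. -/
lemma lintegral_infinitePi_change {μ ν : ι → Measure E} [∀ i, IsProbabilityMeasure (μ i)]
    [∀ i, IsProbabilityMeasure (ν i)] {h : ι → E → ℝ≥0∞} (hh : ∀ i, Measurable (h i))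
    (hν : ∀ i, ν i = (μ i).withDensity (h i)) (T : Finset ι) {G : (ι → E) → ℝ≥0∞}
    (hG : Measurable G) (hGT : ∀ x y : ι → E, (∀ i ∈ T, x i = y i) → G x = G y) :
    ∫⁻ x, G x ∂(Measure.infinitePi ν)
      = ∫⁻ x, G x * ∏ i ∈ T, h i (x i) ∂(Measure.infinitePi μ) := by
  classical
  rcases isEmpty_or_nonempty ι with hι | ⟨⟨i₀⟩⟩
  · have hT : T = ∅ := Finset.eq_empty_of_isEmpty T
    have : μ = ν := Subsingleton.elim _ _
    simp [hT, this]
  obtain ⟨e⟩ : Nonempty E := nonempty_of_isProbabilityMeasure (μ i₀)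
  -- The filler `e` is immaterial because `G` depends only on the coordinates in `T`.
  let ext : (T → E) → ι → E := fun x i => if hi : i ∈ T then x ⟨i, hi⟩ else e
  have hext : Measurable ext := by
    refine measurable_pi_iff.2 fun i => ?_
    by_cases hi : i ∈ T
    · simpa [ext, hi] using measurable_pi_apply (⟨i, hi⟩ : T)
    · simp [ext, hi]
  have h1 : ∀ x, G x = (G ∘ ext) (T.restrict x) := fun x =>
    hGT _ _ fun i hi => by simp [ext, hi]
  have h2 : ∀ x : ι → E, ∏ i ∈ T, h i (x i) = ∏ i : T, h i (T.restrict x i) := fun x =>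
    (Finset.prod_coe_sort T fun i => h i (x i)).symm
  have h3 : Measurable fun y : T → E => ∏ i : T, h i (y i) :=
    Finset.measurable_prod _ fun i _ => (hh i).comp (measurable_pi_apply i)
  have hGe : Measurable (G ∘ ext) := hG.comp hext
  simp only [h1, h2]
  rw [lintegral_restrict_infinitePi (μ := ν) hGe,
    lintegral_restrict_infinitePi (μ := μ)
      (f := fun y => (G ∘ ext) y * ∏ i : T, h i (y i)) (hGe.mul h3),
    pi_withDensity (μ := fun i : T => μ i) (h := fun i : T => h i) (fun i => hh i) fun i => hν i,
    lintegral_withDensity_eq_lintegral_mul _ h3 hGe]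
  exact lintegral_congr fun y => mul_comm _ _

end Product

/-! ### The queues and the outcomes as functions of the noise -/

section Outcomes

variable {L : ℕ}

/-- Queue contents at the beginning of the slots, as a function of the noise. -/
def queue (d : Finset ℕ → ℕ) (w : Contents L) (ξ : ℕ → SlotNoise L) : ℕ → Contents L
  | 0 => w
  | k + 1 => advance (queue d w ξ k) (attempt d (queue d w ξ k) (ξ k)) (ξ k).1

/-- Outcomes of the slots, as a function of the noise. -/
def outcome (d : Finset ℕ → ℕ) (w : Contents L) (ξ : ℕ → SlotNoise L) (k : ℕ) :
    Outcome (Fin L × ℕ) :=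
  attempt d (queue d w ξ k) (ξ k)

lemma contents_eq_queue {E : Type*} (d : Finset ℕ → ℕ) (ω : SampleSpace L E) (k : ℕ) :
    contents d ω k = queue d ω.1 ω.2.1 k := by
  induction k with
  | zero => rfl
  | succ k ih => rw [contents, queue, ih]

lemma queue_consSeq (d : Finset ℕ → ℕ) (w : Contents L) (x : SlotNoise L) (ξ : ℕ → SlotNoise L)
    (k : ℕ) :
    queue d w (consSeq x ξ) (k + 1) = queue d (advance w (attempt d w x) x.1) ξ k := by
  induction k with
  | zero => rfl
  | succ k ih => rw [queue, ih]; rfl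

lemma outcome_consSeq (d : Finset ℕ → ℕ) (w : Contents L) (x : SlotNoise L)
    (ξ : ℕ → SlotNoise L) (k : ℕ) :
    outcome d w (consSeq x ξ) (k + 1) = outcome d (advance w (attempt d w x) x.1) ξ k := by
  rw [outcome, queue_consSeq]; rfl

lemma measurable_queue (d : Finset ℕ → ℕ) (k : ℕ) :
    Measurable fun q : Contents L × (ℕ → SlotNoise L) => queue d q.1 q.2 k := by
  induction k with
  | zero => exact measurable_fst
  | succ k ih =>
    have h : Measurable fun c : Contents L × SlotNoise L => advance c.1 (attempt d c.1 c.2) c.2.1 :=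
      measurable_of_countable _
    have h2 := h.comp (ih.prodMk ((measurable_pi_apply k).comp measurable_snd))
    exact h2

lemma measurable_outcome (d : Finset ℕ → ℕ) (k : ℕ) :
    Measurable fun q : Contents L × (ℕ → SlotNoise L) => outcome d q.1 q.2 k := by
  have h : Measurable fun c : Contents L × SlotNoise L => attempt d c.1 c.2 :=
    measurable_of_countable _
  have h2 := h.comp ((measurable_queue d k).prodMk ((measurable_pi_apply k).comp measurable_snd))
  exact h2

lemma measurable_outcome_right (d : Finset ℕ → ℕ) (w : Contents L) (k : ℕ) :
    Measurable fun ξ : ℕ → SlotNoise L => outcome d w ξ k := by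
  have h := (measurable_outcome (L := L) d k).comp (measurable_prodMk_left (x := w))
  exact h

lemma measurable_outcomes (d : Finset ℕ → ℕ) (w : Contents L) (n : ℕ) :
    Measurable fun (ξ : ℕ → SlotNoise L) (k : Fin n) => outcome d w ξ k :=
  measurable_pi_iff.2 fun k => measurable_outcome_right d w k

/-- The law of the noise of all slots. -/
noncomputable def noiseLaw (L : ℕ) (r p : I) : Measure (ℕ → SlotNoise L) :=
  Measure.infinitePi fun _ => slotLaw L r p

instance (r p : I) : IsProbabilityMeasure (noiseLaw L r p) := by
  unfold noiseLaw
  infer_instance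

lemma noiseLaw_isValid_ae (r p : I) : ∀ᵐ ξ ∂(noiseLaw L r p), ∀ k, IsValid (ξ k) := by
  rw [ae_all_iff]
  intro k
  exact (measurePreserving_eval_infinitePi (fun _ : ℕ => slotLaw L r p)
    k).quasiMeasurePreserving.ae (isValid_ae r p)

/-- The one-slot bound is uniform in the contents, so it multiplies along the slots although the
outcomes are dependent. -/
lemma lintegral_prod_outcome_le {d : Finset ℕ → ℕ} {r p : I} {φ : Outcome (Fin L × ℕ) → ℝ≥0∞}
    {C : ℝ≥0∞} (hφ : ∀ w, ∫⁻ x, φ (attempt d w x) ∂(slotLaw L r p) ≤ C) (n : ℕ) (w : Contents L) :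
    ∫⁻ ξ, ∏ k ∈ Finset.range n, φ (outcome d w ξ k) ∂(noiseLaw L r p) ≤ C ^ n := by
  have hm : ∀ n w, Measurable fun ξ : ℕ → SlotNoise L =>
      ∏ k ∈ Finset.range n, φ (outcome d w ξ k) := fun n w =>
    Finset.measurable_prod _ fun k _ =>
      (measurable_of_countable φ).comp (measurable_outcome_right d w k)
  induction n generalizing w with
  | zero => simp
  | succ n ih =>
    rw [noiseLaw, lintegral_infinitePi_cons _ (hm _ _)]
    calc _ ≤ ∫⁻ x, C ^ n * φ (attempt d w x) ∂(slotLaw L r p) := by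
          refine lintegral_mono fun x => ?_
          simp only [Finset.prod_range_succ', outcome_consSeq]
          exact (lintegral_mul_const _ (hm n _)).le.trans (mul_le_mul' (ih _) le_rfl)
      _ ≤ C ^ n * C := by
          rw [lintegral_const_mul _ (measurable_of_countable _)]
          exact mul_le_mul' le_rfl (hφ w)
      _ = C ^ (n + 1) := (pow_succ C n).symm

/-- The likelihood ratio of the channel in one slot. -/
noncomputable def channelRatio {α : Type*} (p₀ p₁ : I) : Outcome α → ℝ≥0∞
  | Sum.inl _ => 1
  | Sum.inr (Sum.inl _) => ENNReal.ofReal ((1 - p₁) / (1 - p₀))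
  | Sum.inr (Sum.inr _) => ENNReal.ofReal (p₁ / p₀)

/-- Only the weights of the two flag values change. In an idle slot the flag has no effect on the
outcome and the weights add up to `1`. The arrivals stay in `g` because they enter the next
contents. -/
lemma lintegral_attempt_change {p₀ p₁ : I} (h0 : (0 : ℝ) < p₀) (hp : p₀ = 1 → p₁ = 1)
    (d : Finset ℕ → ℕ) (r : I) (w : Contents L)
    (g : Outcome (Fin L × ℕ) → (Fin L → Bool) → ℝ≥0∞) :
    ∫⁻ x, g (attempt d w x) x.1 ∂(slotLaw L r p₁)
      = ∫⁻ x, channelRatio p₀ p₁ (attempt d w x) * g (attempt d w x) x.1 ∂(slotLaw L r p₀) := by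
  rw [lintegral_slotLaw, lintegral_slotLaw]
  refine lintegral_congr fun c => ?_
  have h1 : ENNReal.ofReal p₀ * ENNReal.ofReal (p₁ / p₀) = ENNReal.ofReal p₁ := by
    rw [← ENNReal.ofReal_mul p₀.2.1, mul_div_cancel₀ _ h0.ne']
  have h2 : ENNReal.ofReal (1 - p₀) * ENNReal.ofReal ((1 - p₁) / (1 - p₀))
      = ENNReal.ofReal (1 - p₁) := by
    rw [← ENNReal.ofReal_mul (sub_nonneg.2 p₀.2.2)]
    -- If `p₀ = 1` the quotient has the default value `0`, and `p₁ = 1` makes both sides vanish.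
    by_cases h : (1 : ℝ) - p₀ = 0
    · have : p₁ = 1 := hp (Subtype.ext (by simpa using (sub_eq_zero.1 h).symm))
      simp [this]
    · rw [mul_div_cancel₀ _ h]
  have h3 : ∀ p : I, ENNReal.ofReal p + ENNReal.ofReal (1 - p) = 1 := fun p => by
    rw [← ENNReal.ofReal_add p.2.1 (sub_nonneg.2 p.2.2)]; simp
  by_cases h : (active w).Nonempty
  · simp only [attempt, h, dite_true, if_true, if_false, Bool.false_eq_true, channelRatio,
      ← mul_assoc, h1, h2]
  · simp only [attempt, h, dite_false, channelRatio, one_mul, ← add_mul, h3]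

lemma lintegral_outcomes_change {p₀ p₁ : I} (h0 : (0 : ℝ) < p₀) (hp : p₀ = 1 → p₁ = 1)
    (d : Finset ℕ → ℕ) (r : I) (n : ℕ) (w : Contents L)
    (H : (Fin n → Outcome (Fin L × ℕ)) → ℝ≥0∞) :
    ∫⁻ ξ, H (fun k => outcome d w ξ k) ∂(noiseLaw L r p₁)
      = ∫⁻ ξ, H (fun k => outcome d w ξ k) * ∏ k : Fin n, channelRatio p₀ p₁ (outcome d w ξ k)
        ∂(noiseLaw L r p₀) := by
  have hm : ∀ (n : ℕ) (w : Contents L) (H : (Fin n → Outcome (Fin L × ℕ)) → ℝ≥0∞),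
      Measurable fun ξ : ℕ → SlotNoise L => H (fun k => outcome d w ξ k) := fun n w H =>
    (measurable_of_countable H).comp (measurable_outcomes d w n)
  induction n generalizing w with
  | zero => simp [Subsingleton.elim (fun k : Fin 0 => _) Fin.elim0]
  | succ n ih =>
    rw [noiseLaw, noiseLaw, lintegral_infinitePi_cons _ (hm _ _ _),
      lintegral_infinitePi_cons _ (hm (n + 1) w fun v => H v * ∏ k, channelRatio p₀ p₁ (v k))]
    have hv : ∀ x ξ, (fun k : Fin (n + 1) => outcome d w (consSeq x ξ) k)
        = Fin.cons (attempt d w x)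
          (fun k : Fin n => outcome d (advance w (attempt d w x) x.1) ξ k) := by
      intro x ξ
      funext k
      refine Fin.cases rfl (fun k => ?_) k
      rw [Fin.cons_succ]
      exact outcome_consSeq d w x ξ k
    have key := lintegral_attempt_change h0 hp d r w fun o A =>
      ∫⁻ ξ, H (Fin.cons o (fun k : Fin n => outcome d (advance w o A) ξ k)) ∂(noiseLaw L r p₁)
    simp only [hv]
    refine key.trans (lintegral_congr fun x => ?_)
    rw [ih _ fun v => H (Fin.cons (attempt d w x) v), ← lintegral_const_mul _
      (hm n _ fun v => H (Fin.cons (attempt d w x) v) * ∏ k, channelRatio p₀ p₁ (v k))]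
    refine lintegral_congr fun ξ => ?_
    rw [Fin.prod_univ_succ]
    simp only [outcome_consSeq, Fin.val_succ]
    exact mul_left_comm _ _ _

end Outcomes

/-! ### Packets are delivered at most once -/

section Fresh

variable {L : ℕ}

lemma mem_advance {w : Contents L} {o : Outcome (Fin L × ℕ)} {A : Fin L → Bool} {u : Fin L} {a : ℕ}
    (h : a ∈ advance w o A u) : a = 0 ∨ ∃ b ∈ depart w o u, a = b + 1 := by
  simp only [advance, Finset.mem_union, Finset.mem_image] at h
  rcases h with ⟨b, hb, rfl⟩ | h
  · exact Or.inr ⟨b, hb, rfl⟩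
  · split_ifs at h
    · exact Or.inl (by simpa using h)
    · simp at h

lemma depart_subset (w : Contents L) (o : Outcome (Fin L × ℕ)) (u : Fin L) :
    depart w o u ⊆ w u := by
  rcases o with _ | _ | ⟨v, a⟩
  · exact Finset.Subset.refl _
  · exact Finset.Subset.refl _
  · simp only [depart]
    by_cases h : u = v
    · subst h
      rw [Function.update_self]
      exact Finset.erase_subset _ _
    · rw [Function.update_of_ne h]

/-- Age and clock grow together, so a waiting packet keeps its sampling slot, while packets that
enter later have later sampling slots. A delivered label therefore never returns. -/
lemma queue_ne_of_delivered {d : Finset ℕ → ℕ} {w : Contents L} {ξ : ℕ → SlotNoise L} {k : ℕ}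
    {u : Fin L} {a : ℕ} (h : outcome d w ξ k = Sum.inr (Sum.inr (u, a))) (m : ℕ) :
    ∀ b ∈ queue d w ξ (k + 1 + m) u, ((k + 1 + m : ℕ) : ℤ) - b ≠ k - a := by
  induction m with
  | zero =>
    intro b hb
    rcases mem_advance hb with rfl | ⟨c, hc, rfl⟩
    · push_cast; omega
    · rw [outcome] at h
      rw [h] at hc
      simp only [depart, Function.update_self, Finset.mem_erase] at hc
      have := hc.1
      push_cast
      omega
  | succ m ih =>
    intro b hb
    rcases mem_advance hb with rfl | ⟨c, hc, rfl⟩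
    · push_cast; omega
    · have := ih c (depart_subset _ _ _ hc)
      push_cast at this ⊢
      omega

lemma outcome_fresh {d : Finset ℕ → ℕ} (hd : ∀ s : Finset ℕ, s.Nonempty → d s ∈ s)
    {w : Contents L} {ξ : ℕ → SlotNoise L} (hξ : ∀ k, IsValid (ξ k)) {k k' : ℕ}
    {x x' : Fin L × ℕ} (h : outcome d w ξ k = Sum.inr (Sum.inr x))
    (h' : outcome d w ξ k' = Sum.inr (Sum.inr x')) (hu : x.1 = x'.1)
    (hJ : (k : ℤ) - x.2 = k' - x'.2) : k = k' := by
  have key : ∀ {k k' : ℕ} {x x' : Fin L × ℕ}, outcome d w ξ k = Sum.inr (Sum.inr x) →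
      outcome d w ξ k' = Sum.inr (Sum.inr x') → x.1 = x'.1 → (k : ℤ) - x.2 = k' - x'.2 →
      ¬ k < k' := by
    rintro k k' ⟨u, a⟩ ⟨u', a'⟩ h h' hu hJ hlt
    obtain ⟨m, rfl⟩ := Nat.exists_eq_add_of_le (Nat.succ_le_of_lt hlt)
    have hadm := admissible_attempt hd (queue d w ξ (k.succ + m)) (hξ (k.succ + m))
    rw [outcome] at h'
    rw [h'] at hadm
    simp only at hu
    subst hu
    exact queue_ne_of_delivered h m a' hadm hJ.symm
  rcases lt_trichotomy k k' with hlt | heq | hlt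
  · exact absurd hlt (key h h' hu hJ)
  · exact heq
  · exact absurd hlt (key h' h hu.symm hJ.symm)

end Fresh

/-! ### The likelihood ratio of the observations -/

section LikelihoodRatio

variable {E : Type*} {L : ℕ}

/-- The observation in the slot with index `k`, given the outcome and the measurements. -/
def observe (X : ℤ × Fin L → E) (k : ℕ) (o : Outcome (Fin L × ℕ)) : Obs L E :=
  o.map fun x => (x.1, (k : ℤ) - x.2, X ((k : ℤ) - x.2, x.1))

lemma obs_eq_observe (d : Finset ℕ → ℕ) (ω : SampleSpace L E) (k : ℕ) :
    obs d ω k = observe ω.2.2 k (outcome d ω.1 ω.2.1 k) := by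
  rw [obs, contents_eq_queue]; rfl

/-- Sampling slot and sensor of the delivered packet. -/
def packet (k : ℕ) : Outcome (Fin L × ℕ) → Option (ℤ × Fin L)
  | Sum.inr (Sum.inr x) => some ((k : ℤ) - x.2, x.1)
  | _ => none

variable [MeasurableSpace E]

/-- The likelihood ratio of the delivered measurement. -/
noncomputable def measurementRatio (f₀ f₁ : Measure E) : Obs L E → ℝ≥0∞
  | Sum.inr (Sum.inr x) => if 1 ≤ x.2.1 then f₁.rnDeriv f₀ x.2.2 else 1
  | _ => 1

/-- The likelihood ratio of one observation. -/
noncomputable def slotRatio (p₀ p₁ : I) (f₀ f₁ : Measure E) (y : Obs L E) : ℝ≥0∞ :=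
  channelRatio p₀ p₁ y * measurementRatio f₀ f₁ y

lemma measurable_slotRatio (p₀ p₁ : I) (f₀ f₁ : Measure E) :
    Measurable (slotRatio p₀ p₁ f₀ f₁ : Obs L E → ℝ≥0∞) := by
  have h1 : Measurable (channelRatio p₀ p₁ : Obs L E → ℝ≥0∞) :=
    measurable_fun_sum measurable_const (measurable_fun_sum measurable_const measurable_const)
  have h2 : Measurable (measurementRatio f₀ f₁ : Obs L E → ℝ≥0∞) := by
    refine measurable_fun_sum measurable_const (measurable_fun_sum measurable_const ?_)
    refine Measurable.ite (measurableSet_le measurable_const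
      (measurable_fst.comp measurable_snd)) ?_ measurable_const
    exact (Measure.measurable_rnDeriv _ _).comp (measurable_snd.comp measurable_snd)
  exact h1.mul h2

lemma measurable_observe (k : ℕ) :
    Measurable fun q : Outcome (Fin L × ℕ) × (ℤ × Fin L → E) => observe q.2 k q.1 := by
  refine measurable_from_prod_countable_right fun o => ?_
  rcases o with _ | _ | x
  · exact measurable_const
  · exact (measurable_const : Measurable fun _ : ℤ × Fin L → E => (Sum.inr (Sum.inl ()) : Obs L E))
  · exact measurable_inr.comp (measurable_inr.comp (by fun_prop))

lemma measurable_obsPath (d : Finset ℕ → ℕ) (n : ℕ) :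
    Measurable (obsPath d n : SampleSpace L E → Fin n → Obs L E) := by
  refine measurable_pi_iff.2 fun k => ?_
  have h0 : Measurable fun ω : SampleSpace L E => (ω.1, ω.2.1) :=
    measurable_fst.prodMk (measurable_fst.comp measurable_snd)
  have h1 := (measurable_outcome (L := L) d k).comp h0
  have h2 := (measurable_observe (E := E) (L := L) k).comp
    (h1.prodMk (measurable_snd.comp measurable_snd))
  simp only [obsPath, obs_eq_observe]
  exact h2

/-- The law of the measurement at a given slot and sensor if the change is at the end of
slot `0`. -/
noncomputable def sampleLaw (f₀ f₁ : Measure E) (i : ℤ × Fin L) : Measure E :=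
  if i.1 ≤ 0 then f₀ else f₁

instance (f₀ f₁ : Measure E) [IsProbabilityMeasure f₀] [IsProbabilityMeasure f₁] (i : ℤ × Fin L) :
    IsProbabilityMeasure (sampleLaw f₀ f₁ i) := by
  unfold sampleLaw
  split_ifs <;> infer_instance

variable {f₀ f₁ : Measure E}

lemma changeLaw_zero (r p₀ p₁ : I) (init : Measure (Contents L)) :
    changeLaw r p₀ p₁ f₀ f₁ init 0 = init.prod ((noiseLaw L r p₁).prod
      (Measure.infinitePi (sampleLaw f₀ f₁))) := by
  rw [changeLaw, noiseLaw]
  congr 3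
  funext x
  simp [sampleLaw]

lemma changeLaw_top (r p₀ p₁ : I) (init : Measure (Contents L)) :
    changeLaw r p₀ p₁ f₀ f₁ init ⊤ = init.prod ((noiseLaw L r p₀).prod
      (Measure.infinitePi fun _ => f₀)) := by
  simp [changeLaw, noiseLaw]

lemma measurementRatio_observe (X : ℤ × Fin L → E) (k : ℕ) (o : Outcome (Fin L × ℕ)) :
    measurementRatio f₀ f₁ (observe X k o)
      = ∏ i ∈ (packet k o).toFinset, if 1 ≤ i.1 then f₁.rnDeriv f₀ (X i) else 1 := by
  rcases o with _ | _ | x <;> simp [observe, packet, measurementRatio, Outcome.map]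

variable [IsProbabilityMeasure f₀] [IsProbabilityMeasure f₁]

/-- For fixed outcomes, `hv` says that the delivered packets are distinct. The product over slots is
then a product of densities over the finite set `T` of coordinates, with density `1` at sampling
slots up to `0`. -/
lemma lintegral_observe_change (hac : f₁ ≪ f₀) {n : ℕ} (v : Fin n → Outcome (Fin L × ℕ))
    (hv : ∀ k k' x x', v k = Sum.inr (Sum.inr x) → v k' = Sum.inr (Sum.inr x') → x.1 = x'.1 →
      ((k : ℕ) : ℤ) - x.2 = (k' : ℕ) - x'.2 → k = k')
    {g : (Fin n → Obs L E) → ℝ≥0∞} (hg : Measurable g) :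
    ∫⁻ X, g (fun k => observe X k (v k)) ∂(Measure.infinitePi (sampleLaw f₀ f₁))
      = ∫⁻ X, g (fun k => observe X k (v k)) * ∏ k : Fin n, measurementRatio f₀ f₁ (observe X k (v k))
        ∂(Measure.infinitePi fun _ : ℤ × Fin L => f₀) := by
  classical
  let T : Finset (ℤ × Fin L) := Finset.univ.biUnion fun k : Fin n => (packet k (v k)).toFinset
  have hT : ∀ X : ℤ × Fin L → E, ∏ k : Fin n, measurementRatio f₀ f₁ (observe X k (v k))
      = ∏ i ∈ T, if 1 ≤ i.1 then f₁.rnDeriv f₀ (X i) else 1 := by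
    intro X
    rw [Finset.prod_biUnion]
    · exact Finset.prod_congr rfl fun k _ => measurementRatio_observe X k (v k)
    · intro k _ k' _ hkk'
      rw [Function.onFun, Finset.disjoint_left]
      intro i hi hi'
      rw [Option.mem_toFinset, Option.mem_def] at hi hi'
      apply hkk'
      rcases hk : v k with _ | _ | x <;> rw [hk] at hi <;> simp only [packet, reduceCtorEq] at hi
      rcases hk' : v k' with _ | _ | x' <;> rw [hk'] at hi' <;>
        simp only [packet, reduceCtorEq] at hi'
      have h := (Option.some.inj hi).trans (Option.some.inj hi').symm
      exact hv k k' x x' hk hk' (congrArg Prod.snd h) (congrArg Prod.fst h)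
  simp only [hT]
  refine lintegral_infinitePi_change (μ := fun _ : ℤ × Fin L => f₀)
    (ν := sampleLaw f₀ f₁) (h := fun i z => if 1 ≤ i.1 then f₁.rnDeriv f₀ z else 1)
    (fun i => ?_) (fun i => ?_) T (G := fun X => g (fun k => observe X k (v k))) ?_ ?_
  · split_ifs
    exacts [Measure.measurable_rnDeriv _ _, measurable_const]
  · by_cases h : 1 ≤ i.1
    · simp only [h, if_true, sampleLaw, if_neg (show ¬ i.1 ≤ 0 by omega)]
      exact (Measure.withDensity_rnDeriv_eq _ _ hac).symm
    · simp only [h, if_false, sampleLaw, if_pos (show i.1 ≤ 0 by omega)]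
      exact withDensity_one.symm
  · refine hg.comp (measurable_pi_iff.2 fun k => ?_)
    have h := (measurable_observe (E := E) (L := L) k).comp (measurable_prodMk_left (x := v k))
    exact h
  · intro X Y hXY
    congr 1
    funext k
    rcases hk : v k with _ | _ | x
    · rfl
    · rfl
    · have h := hXY ((k : ℤ) - x.2, x.1) (Finset.mem_biUnion.2 ⟨k, Finset.mem_univ k, by
        simp [hk, packet]⟩)
      simp [observe, Outcome.map, h]

/-- By Fubini the channel is changed first and then, for almost every noise, the measurements. The
weight depends on the observed path alone. -/
lemma lintegral_obsPath_change {p₀ p₁ : I} (h0 : (0 : ℝ) < p₀) (hp : p₀ = 1 → p₁ = 1)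
    (hac : f₁ ≪ f₀) {d : Finset ℕ → ℕ} (hd : ∀ s : Finset ℕ, s.Nonempty → d s ∈ s) (r : I) (n : ℕ)
    (w : Contents L) {g : (Fin n → Obs L E) → ℝ≥0∞} (hg : Measurable g) :
    ∫⁻ y, g (obsPath d n (w, y))
        ∂((noiseLaw L r p₁).prod (Measure.infinitePi (sampleLaw f₀ f₁)))
      = ∫⁻ y, g (obsPath d n (w, y)) * ∏ k, slotRatio p₀ p₁ f₀ f₁ (obsPath d n (w, y) k)
        ∂((noiseLaw L r p₀).prod (Measure.infinitePi fun _ => f₀)) := by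
  have hpath : ∀ y : (ℕ → SlotNoise L) × (ℤ × Fin L → E),
      obsPath d n (w, y) = fun k : Fin n => observe y.2 k (outcome d w y.1 k) := fun y => by
    funext k
    exact obs_eq_observe d (w, y) k
  have hw : Measurable fun y : (ℕ → SlotNoise L) × (ℤ × Fin L → E) => obsPath d n (w, y) := by
    have h := (measurable_obsPath (E := E) (L := L) d n).comp (measurable_prodMk_left (x := w))
    exact h
  have hR : Measurable fun v : Fin n → Obs L E => ∏ k, slotRatio p₀ p₁ f₀ f₁ (v k) :=
    Finset.measurable_prod _ fun k _ => (measurable_slotRatio p₀ p₁ f₀ f₁).comp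
      (measurable_pi_apply k)
  have hgR := (hg.comp hw).mul (hR.comp hw)
  rw [lintegral_prod (fun y => g (obsPath d n (w, y))) (hg.comp hw).aemeasurable,
    lintegral_prod (fun y => g (obsPath d n (w, y)) *
      ∏ k, slotRatio p₀ p₁ f₀ f₁ (obsPath d n (w, y) k)) hgR.aemeasurable]
  simp only [hpath]
  have h1 := lintegral_outcomes_change h0 hp d r n w fun v =>
    ∫⁻ X, g (fun k => observe X k (v k)) ∂(Measure.infinitePi (sampleLaw f₀ f₁))
  refine h1.trans (lintegral_congr_ae ?_)
  filter_upwards [noiseLaw_isValid_ae r p₀] with ξ hξ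
  have hchan : ∀ (X : ℤ × Fin L → E) k, channelRatio p₀ p₁ (observe X k (outcome d w ξ k))
      = channelRatio p₀ p₁ (outcome d w ξ k) := by
    intro X k
    rcases outcome d w ξ k with _ | _ | x <;> rfl
  simp only [slotRatio, hchan, Finset.prod_mul_distrib]
  have h2 := lintegral_observe_change hac (fun k : Fin n => outcome d w ξ k)
    (fun k k' x x' h h' hu hJ => Fin.ext (outcome_fresh hd hξ h h' hu hJ)) hg
  rw [h2, ← lintegral_mul_const']
  · exact lintegral_congr fun X => by ring
  · refine ENNReal.prod_ne_top fun k _ => ?_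
    rcases outcome d w ξ k with _ | _ | x <;> simp [channelRatio]

/-- The density is the same for all initial contents, so it survives mixing over the contents
compatible with `q`. The mixing measure and the normalisation agree under both laws. -/
lemma condObsLaw_zero_eq_withDensity {p₀ p₁ : I} (h0 : (0 : ℝ) < p₀) (hp : p₀ = 1 → p₁ = 1)
    (hac : f₁ ≪ f₀) {d : Finset ℕ → ℕ} (hd : ∀ s : Finset ℕ, s.Nonempty → d s ∈ s) (r : I)
    (init : Measure (Contents L)) [IsProbabilityMeasure init] (n : ℕ) (q : Fin L → ℕ) :
    condObsLaw d r p₀ p₁ f₀ f₁ init 0 n q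
      = (condObsLaw d r p₀ p₁ f₀ f₁ init ⊤ n q).withDensity
          fun v => ∏ k, slotRatio p₀ p₁ f₀ f₁ (v k) := by
  have hpath := measurable_obsPath (E := E) (L := L) d n
  have hR : Measurable fun v : Fin n → Obs L E => ∏ k, slotRatio p₀ p₁ f₀ f₁ (v k) :=
    Finset.measurable_prod _ fun k _ => (measurable_slotRatio p₀ p₁ f₀ f₁).comp
      (measurable_pi_apply k)
  have hS : MeasurableSet {w : Contents L | queueLength w = q} :=
    (Set.to_countable _).measurableSet
  have hS' : (initialQueue ⁻¹' {q} : Set (SampleSpace L E))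
      = {w : Contents L | queueLength w = q} ×ˢ Set.univ := by
    ext ω; simp [initialQueue]
  have hSm : MeasurableSet (initialQueue ⁻¹' {q} : Set (SampleSpace L E)) := by
    rw [hS']; exact hS.prod .univ
  refine Measure.ext_of_lintegral _ fun g hg => ?_
  rw [lintegral_withDensity_eq_lintegral_mul _ hR hg]
  have hRg := hR.mul hg
  rw [condObsLaw, condObsLaw, lintegral_map hg hpath, lintegral_map hRg hpath,
    ProbabilityTheory.cond, ProbabilityTheory.cond,
    lintegral_smul_measure, lintegral_smul_measure, changeLaw_zero, changeLaw_top, hS',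
    Measure.prod_prod, Measure.prod_prod, measure_univ, measure_univ, ← Measure.prod_restrict,
    ← Measure.prod_restrict, Measure.restrict_univ, Measure.restrict_univ,
    lintegral_prod (fun ω => g (obsPath d n ω)) (hg.comp hpath).aemeasurable]
  congr 1
  refine Eq.trans ?_ (lintegral_prod _ (hRg.comp hpath).aemeasurable).symm
  refine lintegral_congr fun w => ?_
  refine (lintegral_obsPath_change h0 hp hac hd r n w hg).trans ?_
  exact lintegral_congr fun y => mul_comm _ _

instance (r p₀ p₁ : I) (init : Measure (Contents L)) [IsProbabilityMeasure init] :
    IsProbabilityMeasure (changeLaw r p₀ p₁ f₀ f₁ init 0) := by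
  rw [changeLaw_zero]; infer_instance

instance (r p₀ p₁ : I) (init : Measure (Contents L)) [IsProbabilityMeasure init] :
    IsProbabilityMeasure (changeLaw r p₀ p₁ f₀ f₁ init ⊤) := by
  rw [changeLaw_top]; infer_instance

/-- The log-likelihood ratio is the logarithm of the product of the ratios of the slots. -/
lemma logLR_ae_eq {p₀ p₁ : I} (h0 : (0 : ℝ) < p₀) (hp : p₀ = 1 → p₁ = 1)
    (hac : f₁ ≪ f₀) {d : Finset ℕ → ℕ} (hd : ∀ s : Finset ℕ, s.Nonempty → d s ∈ s) (r : I)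
    (init : Measure (Contents L)) [IsProbabilityMeasure init] (n : ℕ) :
    ∀ᵐ ω ∂(changeLaw r p₀ p₁ f₀ f₁ init 0), logLR d r p₀ p₁ f₀ f₁ init 0 n ω
      = Real.log (∏ k ∈ Finset.range n, slotRatio p₀ p₁ f₀ f₁ (obs d ω k)).toReal := by
  have hpath := measurable_obsPath (E := E) (L := L) d n
  have hR : Measurable fun v : Fin n → Obs L E => ∏ k, slotRatio p₀ p₁ f₀ f₁ (v k) :=
    Finset.measurable_prod _ fun k _ => (measurable_slotRatio p₀ p₁ f₀ f₁).comp
      (measurable_pi_apply k)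
  have hSm : ∀ q, MeasurableSet (initialQueue ⁻¹' {q} : Set (SampleSpace L E)) := fun q =>
    measurable_fst (Set.to_countable {w : Contents L | queueLength w = q}).measurableSet
  -- The conditioning value is random in `logLR`; there are countably many, so each is fixed and the
  -- null sets are united.
  have key : ∀ q : Fin L → ℕ, ∀ᵐ ω ∂(changeLaw r p₀ p₁ f₀ f₁ init 0), initialQueue ω = q →
      logLR d r p₀ p₁ f₀ f₁ init 0 n ω
        = Real.log (∏ k ∈ Finset.range n, slotRatio p₀ p₁ f₀ f₁ (obs d ω k)).toReal := by
    intro q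
    have hfin : IsFiniteMeasure (condObsLaw d r p₀ p₁ f₀ f₁ init ⊤ n q) := by
      unfold condObsLaw; infer_instance
    have h1 := Measure.rnDeriv_withDensity (condObsLaw d r p₀ p₁ f₀ f₁ init ⊤ n q) hR
    have h2 := withDensity_absolutelyContinuous (condObsLaw d r p₀ p₁ f₀ f₁ init ⊤ n q)
      fun v => ∏ k, slotRatio p₀ p₁ f₀ f₁ (v k)
    rw [← condObsLaw_zero_eq_withDensity h0 hp hac hd r init n q] at h1 h2
    have h3 := ae_of_ae_map hpath.aemeasurable (h2.ae_le h1)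
    rw [ProbabilityTheory.cond] at h3
    -- The normalising factor is nonzero, hence almost sure statements pass from the conditional law
    -- to the restriction, even when `Q₁ = q` has probability zero.
    have h4 := (ae_restrict_iff' (hSm q)).1
      ((Measure.ae_ennreal_smul_measure_iff (ENNReal.inv_ne_zero.2 (measure_ne_top _ _))).1 h3)
    filter_upwards [h4] with ω hω hq
    rw [logLR, hq, llr, hω hq]
    exact congrArg (fun x : ℝ≥0∞ => Real.log x.toReal)
      (Finset.prod_range fun k => slotRatio p₀ p₁ f₀ f₁ (obs d ω k)).symm
  filter_upwards [ae_all_iff.2 key] with ω hω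
  exact hω _ rfl

end LikelihoodRatio

/-! ### Laws of large numbers -/

section Sequences

lemma tendsto_sum_div_of_finite_support {y : ℕ → ℝ} {N : ℕ} (hy : ∀ k, N ≤ k → y k = 0) :
    Tendsto (fun n : ℕ => (∑ k ∈ Finset.range n, y k) / n) atTop (𝓝 0) := by
  have h := tendsto_const_div_atTop_nhds_zero_nat (∑ k ∈ Finset.range N, y k)
  refine h.congr' ?_
  filter_upwards [eventually_ge_atTop N] with n hn
  congr 1
  refine Finset.sum_subset (Finset.range_mono hn) fun k _ hk => hy k ?_
  simpa using hk

lemma sum_ite_eq_sum_nth (P : ℕ → Prop) [DecidablePred P] (y : ℕ → ℝ) (n : ℕ) :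
    ∑ k ∈ Finset.range n, (if P k then y k else 0)
      = ∑ m ∈ Finset.range (Nat.count P n), y (Nat.nth P m) := by
  induction n with
  | zero => simp
  | succ n ih =>
    rw [Finset.sum_range_succ, ih, Nat.count_succ]
    split_ifs with h
    · rw [Finset.sum_range_succ, Nat.nth_count h]
    · simp

/-- Averages along the times at which `P` holds. -/
lemma tendsto_sum_ite_div (P : ℕ → Prop) [DecidablePred P] {y : ℕ → ℝ} {a c : ℝ}
    (hcount : Tendsto (fun n : ℕ => (∑ k ∈ Finset.range n, if P k then (1 : ℝ) else 0) / n)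
      atTop (𝓝 a))
    (hy : {k | P k}.Infinite →
      Tendsto (fun n : ℕ => (∑ m ∈ Finset.range n, y (Nat.nth P m)) / n) atTop (𝓝 c)) :
    Tendsto (fun n : ℕ => (∑ k ∈ Finset.range n, if P k then y k else 0) / n)
      atTop (𝓝 (a * c)) := by
  by_cases hP : {k | P k}.Infinite
  · have h1 : ∀ n, ∑ k ∈ Finset.range n, (if P k then (1 : ℝ) else 0) = Nat.count P n := fun n => by
      rw [sum_ite_eq_sum_nth P (fun _ => 1)]; simp
    simp only [h1] at hcount
    have h2 : Tendsto (fun n => Nat.count P n) atTop atTop :=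
      tendsto_atTop_atTop.2 fun b => ⟨Nat.nth P b, fun n hn => by
        have := Nat.count_monotone P hn
        rwa [Nat.count_nth_of_infinite hP] at this⟩
    refine (hcount.mul ((hy hP).comp h2)).congr' ?_
    filter_upwards [h2.eventually_gt_atTop 0] with n hn
    rw [sum_ite_eq_sum_nth]
    have : (Nat.count P n : ℝ) ≠ 0 := by exact_mod_cast hn.ne'
    simp only [Function.comp]
    field_simp
  · obtain ⟨N, hN⟩ := (Set.not_infinite.1 hP).bddAbove
    have h1 : ∀ k, N + 1 ≤ k → ¬ P k := fun k hk h => by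
      have := hN h
      omega
    have h2 := tendsto_sum_div_of_finite_support (y := fun k => if P k then (1 : ℝ) else 0)
      fun k hk => if_neg (h1 k hk)
    have h3 := tendsto_sum_div_of_finite_support (y := fun k => if P k then y k else 0)
      fun k hk => if_neg (h1 k hk)
    -- With finitely many such times `a = 0`, so the value of `c` is irrelevant.
    rw [tendsto_nhds_unique hcount h2, zero_mul]
    exact h3

/-- A queue with negative net input grows sublinearly. -/
lemma tendsto_queue_div {V : ℕ → ℕ} {a b : ℕ → ℝ} (hb : ∀ k, b k ≤ 1)
    (hV : ∀ k, (V (k + 1) : ℝ) = V k + a k - if V k ≠ 0 then b k else 0) {δ : ℝ} (hδ : 0 ≤ δ)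
    (hS : Tendsto (fun n : ℕ => (∑ k ∈ Finset.range n, (a k - b k)) / n) atTop (𝓝 (-δ))) :
    Tendsto (fun n : ℕ => (V n : ℝ) / n) atTop (𝓝 0) := by
  set S : ℕ → ℝ := fun n => ∑ k ∈ Finset.range n, (a k - b k) with hSdef
  have hSs : ∀ n, S (n + 1) = S n + (a n - b n) := fun n => Finset.sum_range_succ _ _
  -- Here `m` is the last empty time before `n`, or `0` if there is none. The extra `1` pays for the
  -- service `b m ≤ 1` that is wasted at an empty time.
  have h1 : ∀ n, ∃ m ≤ n, (V n : ℝ) ≤ V 0 + 1 + S n - S m := by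
    intro n
    induction n with
    | zero => exact ⟨0, le_rfl, by simp⟩
    | succ n ih =>
      by_cases h : V n = 0
      · refine ⟨n, Nat.le_succ n, ?_⟩
        rw [hV, hSs, h]
        have := hb n
        have h0 : (0 : ℝ) ≤ V 0 := Nat.cast_nonneg _
        simp
        linarith
      · obtain ⟨m, hm, hle⟩ := ih
        refine ⟨m, hm.trans (Nat.le_succ n), ?_⟩
        rw [hV, hSs, if_pos h]
        linarith
  have h2 : ∀ ε > 0, ∃ C, 0 ≤ C ∧ ∀ n : ℕ, |S n + δ * n| ≤ ε * n + C := by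
    intro ε hε
    obtain ⟨N, hN⟩ := (Metric.tendsto_atTop.1 hS) ε hε
    have hC : ∀ k, 0 ≤ |S k + δ * k| := fun k => abs_nonneg _
    refine ⟨∑ k ∈ Finset.range (N + 1), |S k + δ * k|, Finset.sum_nonneg fun k _ => hC k,
      fun n => ?_⟩
    by_cases hn : n ∈ Finset.range (N + 1)
    · have := Finset.single_le_sum (f := fun k : ℕ => |S k + δ * k|) (fun k _ => hC k) hn
      have h3 : 0 ≤ ε * n := by positivity
      linarith
    · have hn' : N < n := by simpa using hn
      have hn0 : (0 : ℝ) < n := by exact_mod_cast (Nat.zero_le N).trans_lt hn'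
      have h3 := hN n hn'.le
      rw [Real.dist_eq] at h3
      have h4 : S n + δ * n = (S n / n - -δ) * n := by field_simp; ring
      rw [h4, abs_mul, abs_of_pos hn0]
      have h5 := Finset.sum_nonneg fun k (_ : k ∈ Finset.range (N + 1)) => hC k
      have h6 := mul_le_mul_of_nonneg_right h3.le hn0.le
      linarith
  rw [Metric.tendsto_atTop]
  intro ε hε
  -- The errors at `n` and at `m` use `ε / 4` each; the other half of `ε` absorbs the constants.
  obtain ⟨C, hC, hle⟩ := h2 (ε / 4) (by linarith)
  obtain ⟨N, hN⟩ := exists_nat_gt ((V 0 + 1 + 2 * C) / (ε / 2))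
  refine ⟨N + 1, fun n hn => ?_⟩
  have hn0 : (0 : ℝ) < n := by exact_mod_cast Nat.lt_of_lt_of_le (Nat.succ_pos N) hn
  have hNn : (N : ℝ) ≤ n := by exact_mod_cast (Nat.le_succ N).trans hn
  rw [Real.dist_eq, sub_zero, abs_of_nonneg (by positivity), div_lt_iff₀ hn0]
  obtain ⟨m, hm, h3⟩ := h1 n
  have hmn : (m : ℝ) ≤ n := by exact_mod_cast hm
  have h4 := abs_le.1 (hle n)
  have h5 := abs_le.1 (hle m)
  have h6 : δ * m ≤ δ * n := mul_le_mul_of_nonneg_left hmn hδ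
  have h7 : ε / 4 * m ≤ ε / 4 * n := mul_le_mul_of_nonneg_left hmn (by linarith)
  rw [div_lt_iff₀ (by linarith)] at hN
  have h8 : (N : ℝ) * (ε / 2) ≤ n * (ε / 2) := mul_le_mul_of_nonneg_right hNn (by linarith)
  linarith [h4.2, h5.1]

/-- The strong law of large numbers for coordinates of a product measure. -/
lemma infinitePi_strong_law {S : Type*} [MeasurableSpace S] {μ : Measure S} [IsProbabilityMeasure μ]
    {g : S → ℝ} (hg : Measurable g) (hint : Integrable g μ) :
    ∀ᵐ x ∂(Measure.infinitePi fun _ : ℕ => μ),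
      Tendsto (fun n : ℕ => (∑ k ∈ Finset.range n, g (x k)) / n) atTop (𝓝 (∫ s, g s ∂μ)) := by
  have hmp : ∀ k, MeasurePreserving (fun x : ℕ → S => x k) (Measure.infinitePi fun _ : ℕ => μ) μ :=
    fun k => measurePreserving_eval_infinitePi (fun _ : ℕ => μ) k
  have hind : iIndepFun (fun (k : ℕ) (x : ℕ → S) => g (x k)) (Measure.infinitePi fun _ : ℕ => μ) :=
    iIndepFun_infinitePi (X := fun _ => g) fun _ => hg
  have h := strong_law_ae_real (μ := Measure.infinitePi fun _ : ℕ => μ) (fun k x => g (x k))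
    ((hmp 0).integrable_comp_of_integrable hint) (fun i j hij => hind.indepFun hij) fun i =>
      { aemeasurable_fst := (hg.comp (measurable_pi_apply i)).aemeasurable
        aemeasurable_snd := (hg.comp (measurable_pi_apply 0)).aemeasurable
        map_eq := by
          have : ∀ k : ℕ, (Measure.infinitePi fun _ : ℕ => μ).map (fun x => g (x k)) = μ.map g := by
            intro k
            conv_rhs => rw [← (hmp k).map_eq, Measure.map_map hg (hmp k).measurable]
            rfl
          rw [this, this] }
  have h0 : ∫ x, g (x 0) ∂(Measure.infinitePi fun _ : ℕ => μ) = ∫ s, g s ∂μ := by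
    rw [← (hmp 0).map_eq, integral_map (hmp 0).measurable.aemeasurable hg.aestronglyMeasurable,
      (hmp 0).map_eq]
  rwa [h0] at h

end Sequences

/-! ### Concentration of successes given the number of transmissions. -/

section Rates

variable {L : ℕ}

/-- Indicator of a failed transmission. -/
def failed {α : Type*} : Outcome α → ℕ
  | Sum.inr (Sum.inl _) => 1
  | _ => 0

/-- The centred success indicator of a transmission. -/
noncomputable def surplus (p : I) (o : Outcome (Fin L × ℕ)) : ℝ :=
  (1 - p) * delivered 0 o - p * failed o

/-- From `exp x ≤ 1 + x + x ^ 2` for `|x| ≤ 1`: the linear terms cancel by centring, and the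
variance is at most `1`. -/
lemma bernoulli_exp_le (p : I) {t : ℝ} (ht : |t| ≤ 1) :
    p * Real.exp (t * (1 - p)) + (1 - p) * Real.exp (t * -p) ≤ Real.exp (t ^ 2) := by
  have hp0 : (0 : ℝ) ≤ p := p.2.1
  have hp1 : (0 : ℝ) ≤ 1 - p := sub_nonneg.2 p.2.2
  have key : ∀ x : ℝ, |x| ≤ 1 → Real.exp x ≤ 1 + x + x ^ 2 := fun x hx => by
    have := (abs_le.1 (Real.abs_exp_sub_one_sub_id_le hx)).2
    linarith
  have h1 := key (t * (1 - p)) (by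
    rw [abs_mul, abs_of_nonneg hp1]
    exact mul_le_one₀ ht hp1 (by linarith))
  have h2 := key (t * -p) (by
    rw [abs_mul, abs_neg, abs_of_nonneg hp0]
    exact mul_le_one₀ ht hp0 p.2.2)
  have h3 := Real.add_one_le_exp (t ^ 2)
  have h4 := mul_le_mul_of_nonneg_left h1 hp0
  have h5 := mul_le_mul_of_nonneg_left h2 hp1
  have h6 : t ^ 2 * (p * (1 - p)) ≤ t ^ 2 * 1 := by
    refine mul_le_mul_of_nonneg_left ?_ (sq_nonneg t)
    nlinarith
  nlinarith

lemma lintegral_exp_surplus_le (d : Finset ℕ → ℕ) (r p : I) {t : ℝ} (ht : |t| ≤ 1)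
    (w : Contents L) :
    ∫⁻ x, ENNReal.ofReal (Real.exp (t * surplus p (attempt d w x))) ∂(slotLaw L r p)
      ≤ ENNReal.ofReal (Real.exp (t ^ 2)) := by
  rw [lintegral_slotLaw]
  have hp1 : (0 : ℝ) ≤ 1 - p := sub_nonneg.2 p.2.2
  refine (lintegral_mono (g := fun _ => ENNReal.ofReal (Real.exp (t ^ 2))) fun c => ?_).trans
    (by simp)
  simp only
  rw [← ENNReal.ofReal_mul p.2.1, ← ENNReal.ofReal_mul hp1,
    ← ENNReal.ofReal_add (mul_nonneg p.2.1 (Real.exp_nonneg _))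
      (mul_nonneg hp1 (Real.exp_nonneg _))]
  refine ENNReal.ofReal_le_ofReal ?_
  by_cases h : (active w).Nonempty
  · simpa [attempt, h, surplus, delivered, failed] using bernoulli_exp_le p ht
  · simp only [attempt, h, surplus, delivered, failed, dite_false]
    simpa using Real.exp_le_exp.2 (sq_nonneg t)

/-- Chernoff and Borel–Cantelli: the exponential moment is at most `exp (n * t ^ 2)`, so the
exceptional event has probability at most `exp (-t ^ 2 * n)`, which is summable. -/
lemma surplus_eventually_lt (d : Finset ℕ → ℕ) (r p : I) (w : Contents L) {t : ℝ} (ht : |t| ≤ 1)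
    (ht0 : t ≠ 0) :
    ∀ᵐ ξ ∂(noiseLaw L r p), ∀ᶠ n : ℕ in atTop,
      t * ∑ k ∈ Finset.range n, surplus p (outcome d w ξ k) < 2 * t ^ 2 * n := by
  set q : ℝ≥0∞ := ENNReal.ofReal (Real.exp (-t ^ 2)) with hq
  have hq1 : q < 1 := by
    rw [hq, ENNReal.ofReal_lt_one]
    exact Real.exp_lt_one_iff.2 (by have := pow_pos (abs_pos.2 ht0) 2; rw [sq_abs] at this; linarith)
  have hle : ∀ n : ℕ, noiseLaw L r p
      {ξ | 2 * t ^ 2 * n ≤ t * ∑ k ∈ Finset.range n, surplus p (outcome d w ξ k)} ≤ q ^ n := by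
    intro n
    have h1 := lintegral_prod_outcome_le (φ := fun o =>
      ENNReal.ofReal (Real.exp (t * surplus p o))) (fun w => lintegral_exp_surplus_le d r p ht w) n w
    have h2 : ∀ ξ : ℕ → SlotNoise L,
        ∏ k ∈ Finset.range n, ENNReal.ofReal (Real.exp (t * surplus p (outcome d w ξ k)))
          = ENNReal.ofReal (Real.exp (t * ∑ k ∈ Finset.range n, surplus p (outcome d w ξ k))) := by
      intro ξ
      rw [← ENNReal.ofReal_prod_of_nonneg fun _ _ => Real.exp_nonneg _, ← Real.exp_sum,
        Finset.mul_sum]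
    simp only [h2] at h1
    have hmeas : Measurable fun ξ : ℕ → SlotNoise L => ENNReal.ofReal
        (Real.exp (t * ∑ k ∈ Finset.range n, surplus p (outcome d w ξ k))) := by
      have h3 : ∀ k, Measurable fun ξ : ℕ → SlotNoise L => surplus p (outcome d w ξ k) := fun k =>
        (measurable_of_countable (surplus p)).comp (measurable_outcome_right d w k)
      exact ENNReal.measurable_ofReal.comp (Real.measurable_exp.comp
        ((Finset.measurable_sum _ fun k _ => h3 k).const_mul t))
    have h4 := (mul_meas_ge_le_lintegral (μ := noiseLaw L r p) hmeas
      (ENNReal.ofReal (Real.exp (2 * t ^ 2 * n)))).trans h1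
    have h5 : {ξ : ℕ → SlotNoise L |
        2 * t ^ 2 * n ≤ t * ∑ k ∈ Finset.range n, surplus p (outcome d w ξ k)}
        = {ξ | ENNReal.ofReal (Real.exp (2 * t ^ 2 * n)) ≤ ENNReal.ofReal
          (Real.exp (t * ∑ k ∈ Finset.range n, surplus p (outcome d w ξ k)))} := by
      ext ξ
      simp [ENNReal.ofReal_le_ofReal_iff (Real.exp_nonneg _)]
    rw [h5]
    have h6 : q ^ n * ENNReal.ofReal (Real.exp (2 * t ^ 2 * n))
        = ENNReal.ofReal (Real.exp (t ^ 2)) ^ n := by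
      rw [hq, ← ENNReal.ofReal_pow (Real.exp_nonneg _), ← ENNReal.ofReal_pow (Real.exp_nonneg _),
        ← ENNReal.ofReal_mul (by positivity), ← Real.exp_nat_mul, ← Real.exp_nat_mul,
        ← Real.exp_add]
      congr 2
      ring
    rw [← h6, mul_comm (q ^ n)] at h4
    refine (ENNReal.mul_le_mul_iff_right ?_ ENNReal.ofReal_ne_top).1 h4
    simpa using Real.exp_pos _
  have hsum : ∑' n : ℕ, noiseLaw L r p
      {ξ | 2 * t ^ 2 * n ≤ t * ∑ k ∈ Finset.range n, surplus p (outcome d w ξ k)} ≠ ∞ := by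
    refine ne_top_of_le_ne_top ?_ (ENNReal.tsum_le_tsum hle)
    rw [ENNReal.tsum_geometric]
    exact ENNReal.inv_ne_top.2 (tsub_pos_of_lt hq1).ne'
  filter_upwards [ae_eventually_notMem hsum] with ξ hξ
  filter_upwards [hξ] with n hn
  exact not_le.1 hn

lemma tendsto_surplus (d : Finset ℕ → ℕ) (r p : I) (w : Contents L) :
    ∀ᵐ ξ ∂(noiseLaw L r p), Tendsto (fun n : ℕ =>
      (∑ k ∈ Finset.range n, surplus p (outcome d w ξ k)) / n) atTop (𝓝 0) := by
  -- Using `t = ± 1 / (m + 1)` bounds both signs of the average by `2 / (m + 1)`; countably many `t`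
  -- suffice.
  have h1 : ∀ m : ℕ, (0 : ℝ) < 1 / (m + 1) ∧ |(1 : ℝ) / (m + 1)| ≤ 1 := fun m => by
    have h : (0 : ℝ) < 1 / (m + 1) := by positivity
    refine ⟨h, ?_⟩
    rw [abs_of_pos h, div_le_one (by positivity)]
    linarith [(Nat.cast_nonneg m : (0 : ℝ) ≤ m)]
  have h2 := ae_all_iff.2 fun m : ℕ => surplus_eventually_lt d r p w (h1 m).2 (h1 m).1.ne'
  have h3 := ae_all_iff.2 fun m : ℕ => surplus_eventually_lt d r p w
    (t := -(1 / (m + 1))) (by rw [abs_neg]; exact (h1 m).2) (neg_ne_zero.2 (h1 m).1.ne')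
  filter_upwards [h2, h3] with ξ hξ hξ'
  rw [Metric.tendsto_atTop']
  intro ε hε
  obtain ⟨m, hm⟩ := exists_nat_one_div_lt (half_pos hε)
  obtain ⟨N, hN⟩ := eventually_atTop.1 ((hξ m).and (hξ' m))
  refine ⟨N, fun n hn => ?_⟩
  obtain ⟨h4, h5⟩ := hN n hn.le
  have hn0 : (0 : ℝ) < n := by exact_mod_cast (Nat.zero_le N).trans_lt hn
  have ht := (h1 m).1
  set t : ℝ := 1 / (m + 1)
  set s := ∑ k ∈ Finset.range n, surplus p (outcome d w ξ k)
  have h6 : s < 2 * t * n := by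
    by_contra! h
    nlinarith
  have h7 : -s < 2 * t * n := by
    by_contra! h
    nlinarith
  rw [Real.dist_eq, sub_zero, abs_div, abs_of_pos hn0, div_lt_iff₀ hn0, abs_lt]
  have h8 : 2 * t * n < ε * n := mul_lt_mul_of_pos_right (by linarith) hn0
  constructor <;> linarith

end Rates

/-! ### The rates of deliveries and failures -/

section DeliveryRates

variable {L : ℕ}

/-- Sampling slot and sensor of the delivered packet, if it was sampled after the change. -/
def freshPacket (k : ℕ) (o : Outcome (Fin L × ℕ)) : Option (ℤ × Fin L) :=
  (packet k o).filter fun i => 1 ≤ i.1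

lemma delivered_sub_delivered (k : ℕ) (o : Outcome (Fin L × ℕ)) :
    (if (freshPacket k o).isSome then (1 : ℝ) else 0) = delivered 0 o - delivered k o := by
  rcases o with _ | _ | ⟨u, a⟩
  · simp [freshPacket, packet, delivered]
  · simp [freshPacket, packet, delivered]
  · by_cases h : k ≤ a
    · have h' : ¬ (1 : ℤ) ≤ k - a := by omega
      simp [freshPacket, packet, delivered, h, h', Option.filter]
    · have h' : (1 : ℤ) ≤ k - a := by omega
      simp [freshPacket, packet, delivered, h, h', Option.filter]

variable {d : Finset ℕ → ℕ}

lemma load_add_sum_delivered (hd : ∀ s : Finset ℕ, s.Nonempty → d s ∈ s)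
    (w : Contents L) {ξ : ℕ → SlotNoise L} (hξ : ∀ k, IsValid (ξ k))
    (n : ℕ) :
    load 0 (queue d w ξ n) + ∑ k ∈ Finset.range n, delivered 0 (outcome d w ξ k)
      = load 0 w + ∑ k ∈ Finset.range n, arrivals (ξ k).1 := by
  induction n with
  | zero => rfl
  | succ n ih =>
    rw [Finset.sum_range_succ, Finset.sum_range_succ]
    have h := load_step hd (queue d w ξ n) (hξ n)
    rw [queue]
    unfold outcome at ih ⊢
    omega

/-- At index `n`, age at least `n` means sampled in a slot `≤ 0`. Deliveries of such packets are
thus bounded in total by the initial load. -/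
lemma load_add_sum_delivered_old (hd : ∀ s : Finset ℕ, s.Nonempty → d s ∈ s)
    (w : Contents L) {ξ : ℕ → SlotNoise L} (hξ : ∀ k, IsValid (ξ k))
    (n : ℕ) :
    load n (queue d w ξ n) + ∑ k ∈ Finset.range n, delivered k (outcome d w ξ k) = load 0 w := by
  induction n with
  | zero => rfl
  | succ n ih =>
    rw [Finset.sum_range_succ]
    have h := load_succ_step hd n (queue d w ξ n) (hξ n)
    rw [queue]
    unfold outcome at ih ⊢
    omega

/-- Deliveries are arrivals plus the initial load minus the backlog, which is sublinear. Failures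
follow from the vanishing average of `surplus`, and old packets do not affect the rate. -/
lemma delivery_rates (hd : ∀ s : Finset ℕ, s.Nonempty → d s ∈ s)
    {r p : I} (hstable : (L : ℝ) * r < p) (w : Contents L) :
    ∀ᵐ ξ ∂(noiseLaw L r p),
      Tendsto (fun n : ℕ => (∑ k ∈ Finset.range n, (delivered 0 (outcome d w ξ k) : ℝ)) / n)
        atTop (𝓝 (L * r)) ∧
      Tendsto (fun n : ℕ => (∑ k ∈ Finset.range n, (failed (outcome d w ξ k) : ℝ)) / n)
        atTop (𝓝 ((1 - p) * (L * r / p))) ∧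
      Tendsto (fun n : ℕ => (∑ k ∈ Finset.range n,
        if (freshPacket k (outcome d w ξ k)).isSome then (1 : ℝ) else 0) / n)
        atTop (𝓝 (L * r)) := by
  have hp : (0 : ℝ) < p := lt_of_le_of_lt (mul_nonneg (Nat.cast_nonneg _) r.2.1) hstable
  have h1 := infinitePi_strong_law (μ := slotLaw L r p) (g := fun ξ => (arrivals ξ.1 : ℝ))
    (measurable_of_countable _) Integrable.of_finite
  have h2 := infinitePi_strong_law (μ := slotLaw L r p)
    (g := fun ξ => (arrivals ξ.1 : ℝ) - (if ξ.2.2 = true then 1 else 0))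
    (measurable_of_countable _) Integrable.of_finite
  rw [integral_arrivals] at h1
  rw [integral_sub Integrable.of_finite Integrable.of_finite, integral_arrivals,
    integral_flag r p fun b => if b = true then 1 else 0] at h2
  have h3 := tendsto_surplus d r p w
  filter_upwards [h1, h2, h3, noiseLaw_isValid_ae r p] with ξ h1 h2 h3 hξ
  have hV : Tendsto (fun n : ℕ => (load 0 (queue d w ξ n) : ℝ) / n) atTop (𝓝 0) := by
    -- The flag counts as potential service even in idle slots, which makes `a - b` i.i.d. with mean
    -- `L * r - p`.
    refine tendsto_queue_div (V := fun n => load 0 (queue d w ξ n))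
      (a := fun k => (arrivals (ξ k).1 : ℝ)) (b := fun k => if (ξ k).2.2 = true then 1 else 0)
      (δ := p - L * r) (fun k => ?_) (fun k => ?_) (by linarith) ?_
    · split_ifs <;> norm_num
    · have h := load_step hd (queue d w ξ k) (hξ k)
      rw [delivered_zero_attempt] at h
      rw [eq_sub_iff_add_eq]
      have h4 : (if load 0 (queue d w ξ k) ≠ 0 then
          (if (ξ k).2.2 = true then (1 : ℝ) else 0) else 0)
          = ((if load 0 (queue d w ξ k) ≠ 0 ∧ (ξ k).2.2 = true then 1 else 0 : ℕ) : ℝ) := by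
        split_ifs <;> simp_all
      rw [h4]
      exact_mod_cast h
    · convert h2 using 2
      simp
  have hD : Tendsto (fun n : ℕ => (∑ k ∈ Finset.range n, (delivered 0 (outcome d w ξ k) : ℝ)) / n)
      atTop (𝓝 (L * r)) := by
    have h4 := (h1.add (tendsto_const_div_atTop_nhds_zero_nat (load 0 w : ℝ))).sub hV
    rw [add_zero, sub_zero] at h4
    refine h4.congr fun n => ?_
    have h5 : (load 0 (queue d w ξ n) : ℝ)
        + ∑ k ∈ Finset.range n, (delivered 0 (outcome d w ξ k) : ℝ)
        = load 0 w + ∑ k ∈ Finset.range n, (arrivals (ξ k).1 : ℝ) := by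
      exact_mod_cast load_add_sum_delivered hd w hξ n
    rw [← add_div, ← sub_div]
    congr 1
    linarith
  refine ⟨hD, ?_, ?_⟩
  · have h4 := ((hD.const_mul (1 - p : ℝ)).sub h3).div_const (p : ℝ)
    have h5 : ((1 - p : ℝ) * (L * r) - 0) / p = (1 - p) * (L * r / p) := by ring
    rw [h5] at h4
    refine h4.congr fun n => ?_
    simp only [surplus, Finset.sum_sub_distrib, ← Finset.mul_sum]
    field_simp
    ring
  · have hold : Tendsto (fun n : ℕ =>
        (∑ k ∈ Finset.range n, (delivered k (outcome d w ξ k) : ℝ)) / n) atTop (𝓝 0) := by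
      refine squeeze_zero (fun n => by positivity) (fun n => ?_)
        (tendsto_const_div_atTop_nhds_zero_nat (load 0 w : ℝ))
      refine div_le_div_of_nonneg_right ?_ (Nat.cast_nonneg n)
      have h := load_add_sum_delivered_old hd w hξ n
      exact_mod_cast (Nat.le_add_left _ _).trans h.le
    have h4 := hD.sub hold
    rw [sub_zero] at h4
    refine h4.congr fun n => ?_
    simp only [delivered_sub_delivered, Finset.sum_sub_distrib, sub_div]

end DeliveryRates

/-! ### The limit of the log-likelihood ratio -/

section Limit

variable {E : Type*} [MeasurableSpace E] {L : ℕ} {f₀ f₁ : Measure E}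

/-- The log-likelihood ratio of the measurement of a packet. -/
noncomputable def freshLLR (f₀ f₁ : Measure E) (X : ℤ × Fin L → E) (i : Option (ℤ × Fin L)) : ℝ :=
  i.elim 0 fun j => llr f₁ f₀ (X j)

/-- All factors must be nonzero for the logarithm of the product to split. By `ho` a failure forces
`p₁ ≠ 1`, hence `p₀ ≠ 1` by `hp`. -/
lemma slotRatio_observe {p₀ p₁ : I} (h0 : (0 : ℝ) < p₀) (h1 : (0 : ℝ) < p₁)
    (hp : p₀ = 1 → p₁ = 1) {X : ℤ × Fin L → E}
    (hX : ∀ i : ℤ × Fin L, 1 ≤ i.1 → 0 < f₁.rnDeriv f₀ (X i) ∧ f₁.rnDeriv f₀ (X i) < ∞)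
    (k : ℕ) (o : Outcome (Fin L × ℕ)) (ho : p₁ = 1 → failed o = 0) :
    (slotRatio p₀ p₁ f₀ f₁ (observe X k o)).toReal ≠ 0 ∧
    Real.log (slotRatio p₀ p₁ f₀ f₁ (observe X k o)).toReal
      = Real.log ((1 - p₁) / (1 - p₀)) * failed o + Real.log (p₁ / p₀) * delivered 0 o
        + freshLLR f₀ f₁ X (freshPacket k o) := by
  have hdiv : (0 : ℝ) < p₁ / p₀ := div_pos h1 h0
  rcases o with _ | _ | ⟨u, a⟩
  · simp [slotRatio, observe, Outcome.map, channelRatio, measurementRatio, failed, delivered,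
      freshPacket, packet, freshLLR]
  · have hp1 : p₁ ≠ 1 := fun h => by simpa [failed] using ho h
    have hlt1 : (0 : ℝ) < 1 - p₁ := sub_pos.2 (lt_of_le_of_ne p₁.2.2 fun h => hp1 (Subtype.ext h))
    have hlt0 : (0 : ℝ) < 1 - p₀ :=
      sub_pos.2 (lt_of_le_of_ne p₀.2.2 fun h => hp1 (hp (Subtype.ext h)))
    have hpos : (0 : ℝ) < (1 - p₁) / (1 - p₀) := div_pos hlt1 hlt0
    have h : slotRatio p₀ p₁ f₀ f₁ (observe X k (Sum.inr (Sum.inl ())))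
        = ENNReal.ofReal ((1 - p₁) / (1 - p₀)) := by
      simp [slotRatio, observe, Outcome.map, channelRatio, measurementRatio]
    rw [h, ENNReal.toReal_ofReal hpos.le]
    refine ⟨hpos.ne', ?_⟩
    simp [failed, delivered, freshPacket, packet, freshLLR]
  · by_cases hJ : (1 : ℤ) ≤ k - a
    · have h : slotRatio p₀ p₁ f₀ f₁ (observe X k (Sum.inr (Sum.inr (u, a))))
          = ENNReal.ofReal (p₁ / p₀) * f₁.rnDeriv f₀ (X (k - a, u)) := by
        simp [slotRatio, observe, Outcome.map, channelRatio, measurementRatio, hJ]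
      obtain ⟨hr0, hr1⟩ := hX (k - a, u) hJ
      have hr : (f₁.rnDeriv f₀ (X (k - a, u))).toReal ≠ 0 :=
        (ENNReal.toReal_pos hr0.ne' hr1.ne).ne'
      rw [h, ENNReal.toReal_mul, ENNReal.toReal_ofReal hdiv.le, Real.log_mul hdiv.ne' hr]
      refine ⟨mul_ne_zero hdiv.ne' hr, ?_⟩
      simp [failed, delivered, freshPacket, packet, freshLLR, Option.filter, hJ, llr]
    · have h : slotRatio p₀ p₁ f₀ f₁ (observe X k (Sum.inr (Sum.inr (u, a))))
          = ENNReal.ofReal (p₁ / p₀) := by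
        simp [slotRatio, observe, Outcome.map, channelRatio, measurementRatio, hJ]
      rw [h, ENNReal.toReal_ofReal hdiv.le]
      refine ⟨hdiv.ne', ?_⟩
      simp [failed, delivered, freshPacket, packet, freshLLR, Option.filter, hJ]

variable [IsProbabilityMeasure f₀] [IsProbabilityMeasure f₁]

lemma rnDeriv_sample_ae (hac : f₁ ≪ f₀) :
    ∀ᵐ X ∂(Measure.infinitePi (sampleLaw (L := L) f₀ f₁)), ∀ i : ℤ × Fin L, 1 ≤ i.1 →
      0 < f₁.rnDeriv f₀ (X i) ∧ f₁.rnDeriv f₀ (X i) < ∞ := by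
  rw [ae_all_iff]
  intro i
  by_cases hi : 1 ≤ i.1
  · have h1 : ∀ᵐ z ∂(sampleLaw f₀ f₁ i), 0 < f₁.rnDeriv f₀ z ∧ f₁.rnDeriv f₀ z < ∞ := by
      rw [sampleLaw, if_neg (by omega)]
      exact (Measure.rnDeriv_pos hac).and (hac.ae_le (Measure.rnDeriv_lt_top f₁ f₀))
    have h2 := (measurePreserving_eval_infinitePi (sampleLaw (L := L) f₀ f₁)
      i).quasiMeasurePreserving.ae h1
    filter_upwards [h2] with X hX _
    exact hX
  · exact ae_of_all _ fun X h => absurd h hi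

/-- The average log-likelihood ratio of measurements along the deliveries. -/
lemma tendsto_freshLLR (hint : Integrable (llr f₁ f₀) f₁) {d : Finset ℕ → ℕ}
    (hd : ∀ s : Finset ℕ, s.Nonempty → d s ∈ s) (w : Contents L) {ξ : ℕ → SlotNoise L}
    (hξ : ∀ k, IsValid (ξ k)) {a : ℝ}
    (ha : Tendsto (fun n : ℕ => (∑ k ∈ Finset.range n,
        if (freshPacket k (outcome d w ξ k)).isSome then (1 : ℝ) else 0) / n) atTop (𝓝 a)) :
    ∀ᵐ X ∂(Measure.infinitePi (sampleLaw (L := L) f₀ f₁)),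
      Tendsto (fun n : ℕ => (∑ k ∈ Finset.range n,
        freshLLR f₀ f₁ X (freshPacket k (outcome d w ξ k))) / n) atTop
        (𝓝 (a * ∫ z, llr f₁ f₀ z ∂f₁)) := by
  set P : ℕ → Prop := fun k => (freshPacket k (outcome d w ξ k)).isSome = true with hP
  have hsum : ∀ X : ℤ × Fin L → E, (fun k => freshLLR f₀ f₁ X (freshPacket k (outcome d w ξ k)))
      = fun k => if P k then freshLLR f₀ f₁ X (freshPacket k (outcome d w ξ k)) else 0 := by
    intro X
    funext k
    simp only [hP]
    cases freshPacket k (outcome d w ξ k) <;> simp [freshLLR]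
  by_cases hinf : {k | P k}.Infinite
  · have hmem : ∀ m, P (Nat.nth P m) := fun m => Nat.nth_mem_of_infinite hinf m
    -- The coordinate of the `m`-th delivery sampled after the change. It is a function of the fixed
    -- noise and is injective, so the measurements along it are i.i.d. with law `f₁`.
    let idx : ℕ → ℤ × Fin L := fun m =>
      (freshPacket (Nat.nth P m) (outcome d w ξ (Nat.nth P m))).get (hmem m)
    have hidx : ∀ m, freshPacket (Nat.nth P m) (outcome d w ξ (Nat.nth P m)) = some (idx m) :=
      fun m => (Option.some_get (hmem m)).symm
    have hspec : ∀ m, packet (Nat.nth P m) (outcome d w ξ (Nat.nth P m)) = some (idx m) ∧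
        1 ≤ (idx m).1 := fun m => by
      have h := hidx m
      rw [freshPacket, Option.filter_eq_some_iff] at h
      exact ⟨h.1, by simpa using h.2⟩
    have hinj : Function.Injective idx := by
      intro m m' h
      apply Nat.nth_injective hinf
      have h1 := (hspec m).1
      have h2 := (hspec m').1
      rw [← h] at h2
      rcases hk : outcome d w ξ (Nat.nth P m) with _ | _ | x <;> rw [hk] at h1 <;>
        simp only [packet, reduceCtorEq] at h1
      rcases hk' : outcome d w ξ (Nat.nth P m') with _ | _ | x' <;> rw [hk'] at h2 <;>
        simp only [packet, reduceCtorEq] at h2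
      have h3 := (Option.some.inj h1).trans (Option.some.inj h2).symm
      exact outcome_fresh hd hξ hk hk' (congrArg Prod.snd h3) (congrArg Prod.fst h3)
    have hmap := Measure.map_infinitePi_infinitePi_of_inj (P := sampleLaw (L := L) f₀ f₁) hinj
    have hlaw : (fun m => sampleLaw (L := L) f₀ f₁ (idx m)) = fun _ => f₁ := by
      funext m
      have := (hspec m).2
      rw [sampleLaw, if_neg (by omega)]
    have hslln := infinitePi_strong_law (measurable_llr f₁ f₀) hint
    have hmap' : (Measure.infinitePi (sampleLaw (L := L) f₀ f₁)).map (fun X m => X (idx m))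
        = Measure.infinitePi fun _ : ℕ => f₁ := by
      rw [hmap]
      congr 1
    rw [← hmap'] at hslln
    have hae := ae_of_ae_map (measurable_pi_iff.2 fun m => measurable_pi_apply _).aemeasurable hslln
    filter_upwards [hae] with X hX
    rw [show (fun n : ℕ => (∑ k ∈ Finset.range n,
        freshLLR f₀ f₁ X (freshPacket k (outcome d w ξ k))) / n)
      = fun n : ℕ => (∑ k ∈ Finset.range n,
        if P k then freshLLR f₀ f₁ X (freshPacket k (outcome d w ξ k)) else 0) / (n : ℝ) from
      funext fun n => by rw [← hsum X]]
    refine tendsto_sum_ite_div P ha fun _ => ?_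
    simp only [hidx]
    exact hX
  · refine ae_of_all _ fun X => ?_
    rw [show (fun n : ℕ => (∑ k ∈ Finset.range n,
        freshLLR f₀ f₁ X (freshPacket k (outcome d w ξ k))) / n)
      = fun n : ℕ => (∑ k ∈ Finset.range n,
        if P k then freshLLR f₀ f₁ X (freshPacket k (outcome d w ξ k)) else 0) / (n : ℝ) from
      funext fun n => by rw [← hsum X]]
    exact tendsto_sum_ite_div P ha fun h => absurd h hinf

lemma failed_eq_zero {d : Finset ℕ → ℕ} {w : Contents L} {ξ : SlotNoise L} (h : ξ.2.2 = true) :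
    failed (attempt d w ξ) = 0 := by
  rcases attempt_cases d w ξ with ⟨-, h'⟩ | ⟨-, hb, h'⟩ | ⟨-, -, x, h'⟩
  · rw [h']; rfl
  · rw [h] at hb; simp at hb
  · rw [h']; rfl

/-- Outcomes do not involve the measurements, so Fubini allows the contents and the noise to be
fixed before the strong law for the measurements is applied. -/
lemma tendsto_log_slotRatio {r p₀ p₁ : I} (h0 : (0 : ℝ) < p₀) (hp : p₀ = 1 → p₁ = 1)
    (hstable : (L : ℝ) * r < p₁) (hac : f₁ ≪ f₀) (hint : Integrable (llr f₁ f₀) f₁)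
    {d : Finset ℕ → ℕ} (hd : ∀ s : Finset ℕ, s.Nonempty → d s ∈ s)
    (init : Measure (Contents L)) [IsProbabilityMeasure init] :
    ∀ᵐ ω ∂(changeLaw r p₀ p₁ f₀ f₁ init 0), Tendsto (fun n : ℕ => (1 / (n : ℝ)) *
      Real.log (∏ k ∈ Finset.range n, slotRatio p₀ p₁ f₀ f₁ (obs d ω k)).toReal) atTop
      (𝓝 (Real.log ((1 - p₁) / (1 - p₀)) * ((1 - p₁) * (L * r / p₁))
        + Real.log (p₁ / p₀) * (L * r) + L * r * ∫ z, llr f₁ f₀ z ∂f₁)) := by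
  have h1 : (0 : ℝ) < p₁ := lt_of_le_of_lt (mul_nonneg (Nat.cast_nonneg _) r.2.1) hstable
  have hmeas : ∀ k, Measurable fun ω : SampleSpace L E =>
      (slotRatio p₀ p₁ f₀ f₁ (obs d ω k)) := fun k =>
    (measurable_slotRatio p₀ p₁ f₀ f₁).comp
      ((measurable_pi_apply (Fin.last k)).comp (measurable_obsPath d (k + 1)))
  have hms : MeasurableSet {ω : SampleSpace L E | Tendsto (fun n : ℕ => (1 / (n : ℝ)) *
      Real.log (∏ k ∈ Finset.range n, slotRatio p₀ p₁ f₀ f₁ (obs d ω k)).toReal) atTop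
      (𝓝 (Real.log ((1 - p₁) / (1 - p₀)) * ((1 - p₁) * (L * r / p₁))
        + Real.log (p₁ / p₀) * (L * r) + L * r * ∫ z, llr f₁ f₀ z ∂f₁))} :=
    measurableSet_tendsto _ fun n => (Real.measurable_log.comp
      (ENNReal.measurable_toReal.comp (Finset.measurable_prod _ fun k _ => hmeas k))).const_mul _
  rw [changeLaw_zero]
  refine (Measure.ae_prod_iff_ae_ae hms).2 (ae_of_all _ fun w => ?_)
  refine (Measure.ae_prod_iff_ae_ae (measurable_prodMk_left hms)).2 ?_
  have hflag : ∀ᵐ ξ ∂(noiseLaw L r p₁), ∀ k, p₁ = 1 → (ξ k).2.2 = true := by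
    rw [ae_all_iff]
    intro k
    by_cases hp1 : p₁ = 1
    · have := (measurePreserving_eval_infinitePi (fun _ : ℕ => slotLaw L r p₁)
        k).quasiMeasurePreserving.ae (flag_ae (L := L) (r := r) hp1)
      filter_upwards [this] with ξ hξ _
      exact hξ
    · exact ae_of_all _ fun ξ h => absurd h hp1
  filter_upwards [delivery_rates hd hstable w, hflag, noiseLaw_isValid_ae r p₁]
    with ξ ⟨hD, hF, hN⟩ hfl hξ
  filter_upwards [tendsto_freshLLR (f₀ := f₀) hint hd w hξ hN, rnDeriv_sample_ae hac] with X hX hpos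
  have hlog := fun k => slotRatio_observe h0 h1 hp hpos k (outcome d w ξ k)
    fun h => failed_eq_zero (hfl k h)
  refine (((hF.const_mul _).add (hD.const_mul _)).add hX).congr fun n => ?_
  simp only [obs_eq_observe]
  rw [ENNReal.toReal_prod, Real.log_prod fun k _ => (hlog k).1]
  simp only [fun k => (hlog k).2, Finset.sum_add_distrib, ← Finset.mul_sum]
  ring

end Limit

end LossyLink

/-! ### The asymptotic information rate. -/

theorem mainTheorem6 {E : Type*} [MeasurableSpace E] (L : ℕ) (r p₀ p₁ : I)
    (hr_pos : (0 : ℝ) < r) (hr_lt : (r : ℝ) < 1)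
    (hstable : (L : ℝ) * r < min (p₀ : ℝ) p₁) (hp : p₀ = 1 → p₁ = 1)
    (f₀ f₁ : Measure E) [IsProbabilityMeasure f₀] [IsProbabilityMeasure f₁]
    (hf : InformationTheory.klDiv f₁ f₀ ≠ ⊤)
    (d : Finset ℕ → ℕ) (hd : ∀ s : Finset ℕ, s.Nonempty → d s ∈ s)
    (init : Measure (LossyLink.Contents L)) [IsProbabilityMeasure init] :
    ∃ π : Measure (LossyLink.AugState L E),
      IsProbabilityMeasure π ∧
      (LossyLink.augKernel d r p₁ f₁).Invariant π ∧
      (∀ π' : Measure (LossyLink.AugState L E), IsProbabilityMeasure π' →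
        (LossyLink.augKernel d r p₁ f₁).Invariant π' → π' = π) ∧
      Integrable (LossyLink.slotLLR p₀ p₁ f₀ f₁) π ∧
      (∀ᵐ ω ∂(LossyLink.changeLaw r p₀ p₁ f₀ f₁ init 0),
        Tendsto (fun n : ℕ => (1 / (n : ℝ)) * LossyLink.logLR d r p₀ p₁ f₀ f₁ init 0 n ω)
          atTop (𝓝 (∫ s, LossyLink.slotLLR p₀ p₁ f₀ f₁ s ∂π))) ∧
      ∫ s, LossyLink.slotLLR p₀ p₁ f₀ f₁ s ∂π
        = π.real {s | LossyLink.queueLength s.1 ≠ 0} * LossyLink.klBernoulli p₁ p₀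
          + π.real {s | s.2.IsSuccess} * (InformationTheory.klDiv f₁ f₀).toReal := by
  obtain ⟨hs₀, hs₁⟩ := lt_min_iff.1 hstable
  have hLr : 0 ≤ (L : ℝ) * r := mul_nonneg (Nat.cast_nonneg _) hr_pos.le
  have h0 : (0 : ℝ) < p₀ := hLr.trans_lt hs₀
  have h1 : (0 : ℝ) < p₁ := hLr.trans_lt hs₁
  obtain ⟨hac, hint⟩ := InformationTheory.klDiv_ne_top_iff.1 hf
  -- For measures of equal mass the divergence has no mass correction term.
  have hkl : (InformationTheory.klDiv f₁ f₀).toReal = ∫ z, llr f₁ f₀ z ∂f₁ :=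
    InformationTheory.toReal_klDiv_of_measure_eq hac (by simp)
  obtain ⟨π, hπ, hinv, huniq⟩ := LossyLink.existsUnique_invariant_augKernel hr_lt hs₁ hd f₁
  have hval := LossyLink.integral_slotLLR (p₀ := p₀) hinv hint
  have hsucc := LossyLink.stationary_rate hinv hd
  have hbusy := LossyLink.stationary_success hinv
  refine ⟨π, hπ, hinv, huniq, LossyLink.integrable_slotLLR hinv hint, ?_, by rw [hval, hkl]⟩
  filter_upwards [LossyLink.tendsto_log_slotRatio h0 hp hs₁ hac hint hd init,
    ae_all_iff.2 fun n => LossyLink.logLR_ae_eq h0 hp hac hd r init n] with ω hω hlr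
  simp only [hlr]
  convert hω using 2
  -- With success probability `L * r` and busy probability `L * r / p₁`, the stationary mean is the
  -- pathwise limit.
  rw [hval, ← hsucc, hbusy, LossyLink.klBernoulli, mul_div_cancel_right₀ _ h1.ne']
  ring
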